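/- Let $k$ be a field of characteristic $0$. A finite connected quiver $Q$ is called toupie if it has a unique source $0$ and a unique sink $\omega\neq 0$ and every other vertex is the source of exactly one arrow and the target of exactly one arrow. Let $Q$ be a toupie quiver, $I\subset kQ$ an admissible ideal and $A=kQ/I$ (paths are multiplied from left to right). Number the branches, i.e. the paths from $0$ to $\omega$, as $\alpha^{(1)},\dots,\alpha^{(N)}$, in any order, and let $\alpha^i_j$ ($0\le j<|\alpha^{(i)}|$) be the arrows of $\alpha^{(i)}$ in their order. The monomial relations are the paths in $I$ that have no proper subpath in $I$. The non monomial relations are the linear combinations of branches given by the rows with at least two nonzero entries of the reduced row echelon form (for the chosen numbering) of a matrix whose rows span the coefficient vectors of the linear combinations of branches lying in $I$. Let $\mathcal R$ be the set of all monomial and non monomial relations. Let $Z$ be the set of branches that are arrows, $a=\#Z$, and let ${}_0\mathcal B_\omega\supseteq Z$ be the set of branches $\alpha^{(i)}$ that are irreducible, i.e. such that no linear combination of branches lying in $I$ has its first nonzero coefficient at $\alpha^{(i)}$. Let $Q_\rho$ be the graph whose vertices are the branches that are not arrows and contain no monomial relation, two of them being joined if some non monomial relation involves both; let $Q_\rho^1,\dots,Q_\rho^r$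 be its connected components. With $E=kQ_0$, consider the complex $$\mathrm{Hom}_{E^e}(E,A)\xrightarrow{D_0}\mathrm{Hom}_{E^e}(kQ_1,A)\xrightarrow{D_1}\mathrm{Hom}_{E^e}(k\mathcal R,A),$$ where $(D_0c)(\alpha)=\alpha\,c(e_y)-c(e_x)\,\alpha$ for an arrow $\alpha:x\to y$, and $D_1f$ is obtained by sending a path $p$ to $\sum p'f(\beta)p''$, the sum over all factorizations $p=p'\beta p''$ with $\beta$ an arrow, extending linearly, and restricting to $\mathcal R$. For an arrow $\alpha$ and a parallel path $h$ write $\alpha\|h$ for the element of $\mathrm{Hom}_{E^e}(kQ_1,A)$ that sends $\alpha$ to the class of $h$ and the other arrows to $0$. Put $s=\sum_{i=1}^N\alpha^i_0\|\alpha^i_0$ and - $C_1'=\{\alpha^i_j\|\alpha^i_j-\alpha^i_0\|\alpha^i_0 : j\ne 0,\ \alpha^{(i)}$ contains a monomial relation$\}$; - $C_3=\{\alpha^i_j\|\alpha^i_j-\alpha^i_0\|\alpha^i_0 : j\ne 0,\ |\alpha^{(i)}|>1,\ \alpha^{(i)}$ contains no monomial relation$\}$; - $y_i=\alpha^i_0\|\alpha^i_0$,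 for $\alpha^{(i)}$ containing a monomial relation; - $t_k=\sum_{\alpha^{(i)}\in Q_\rho^k}\alpha^i_0\|\alpha^i_0$, for $1\le k\le r$; - $w_{pq}=\alpha^{(p)}\|\alpha^{(q)}$, for $\alpha^{(p)}\neq\alpha^{(q)}$ in $Z$; - $z_{us}=\alpha^{(u)}\|\alpha^{(s)}$, for $\alpha^{(u)}\in Z$ and $\alpha^{(s)}\in{}_0\mathcal B_\omega\setminus Z$; - $x_j=\alpha^{(j)}\|\alpha^{(j)}-\alpha^{(i_0)}\|\alpha^{(i_0)}$, for $\alpha^{(j)}\in Z$, $j\ne i_0$, where $\alpha^{(i_0)}$ is the first element of $Z$. Let $K=\{s\}\cup C_1'\cup C_3$. If $a>0$, let $\widehat U$ consist of $s$, the elements of $C_1'\cup C_3$, and all $y_i,w_{pq},z_{us},x_j,t_k$. If $a=0$, let $\widehat U$ be obtained from $C_1'\cup C_3\cup\{y_i\}_i\cup\{t_k\}_k$ by replacing by $s$ the unique $y_i$ or $t_k$ in which $\alpha^{N}_0\|\alpha^{N}_0$ occurs as a summand ($\alpha^{(N)}$ being the last branch). Theorem. $\mathrm{Im}\,D_0\subseteq\mathrm{Ker}\,D_1$;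 there is a linear isomorphism $\Phi:\mathrm{Ker}\,D_1/\mathrm{Im}\,D_0\to HH^1(A)$ that sends the class of $f$ to the class of the derivation of $A$ that vanishes on the vertices and agrees with $f$ on the arrows; and $\widehat U\setminus K\subseteq\mathrm{Ker}\,D_1$, and the classes of its elements form a basis of $\mathrm{Ker}\,D_1/\mathrm{Im}\,D_0\cong HH^1(A)$. Moreover, if $a>0$, then $\widehat U\setminus K$ consists exactly of the elements $y_i$, $w_{pq}$, $z_{us}$, $x_j$, $t_k$; if $a=0$, it consists of all the $y_i$ and $t_k$ except the one in which $\alpha^{N}_0\|\alpha^{N}_0$ occurs. -/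

import Mathlib

universe u v w

noncomputable section

namespace Toupie

/-! ## Path algebra of a finite quiver -/

/-- All paths of a quiver, with their endpoints. -/
abbrev AnyPath (V : Type u) [Quiver.{v} V] : Type (max u v) :=
  Σ a b : V, Quiver.Path a b

/-- All arrows of a quiver, with their endpoints. -/
abbrev Arrow (V : Type u) [Quiver.{v} V] : Type (max u v) :=
  Σ a b : V, (a ⟶ b)

/-- The path algebra `kQ`: the vector space with basis the paths (trivial ones included). -/
def PathAlgebra (k : Type w) (V : Type u) [Field k] [Quiver.{v} V] : Type (max u v w) :=
  AnyPath V →₀ k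

section PathAlgebra

variable (k : Type w) {V : Type u} [Field k] [Quiver.{v} V]

instance : AddCommGroup (PathAlgebra k V) := inferInstanceAs (AddCommGroup (AnyPath V →₀ k))

instance : Module k (PathAlgebra k V) := inferInstanceAs (Module k (AnyPath V →₀ k))

/-- The basis element of the path algebra given by a path. -/
def ofPath {a b : V} (p : Quiver.Path a b) : PathAlgebra k V :=
  Finsupp.single (⟨a, b, p⟩ : AnyPath V) (1 : k)

open Classical in
/-- Product of two basis paths: concatenation (first `p`, then `q`) when `p` ends where `q`
starts, and `0` otherwise. -/
def pathMul (p q : AnyPath V) : PathAlgebra k V :=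
  if h : p.2.1 = q.1 then ofPath k (p.2.2.comp (q.2.2.cast h.symm rfl)) else 0

/-- The multiplication of the path algebra, extended bilinearly from `pathMul`. -/
def mulMap : PathAlgebra k V →ₗ[k] PathAlgebra k V →ₗ[k] PathAlgebra k V :=
  Finsupp.linearCombination k (M := PathAlgebra k V →ₗ[k] PathAlgebra k V) fun p : AnyPath V =>
    Finsupp.linearCombination k (M := PathAlgebra k V) fun q : AnyPath V => pathMul k p q

instance : Mul (PathAlgebra k V) := ⟨fun x y => mulMap k x y⟩

instance [Fintype V] : One (PathAlgebra k V) := ⟨∑ a : V, ofPath k (Quiver.Path.nil : Quiver.Path a a)⟩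

variable {k}

theorem mul_def (x y : PathAlgebra k V) : x * y = mulMap k x y := rfl

theorem ofPath_mul_ofPath {a b c : V} (p : Quiver.Path a b) (q : Quiver.Path b c) :
    ofPath k p * ofPath k q = ofPath k (p.comp q) := by
  rw [mul_def, mulMap]
  unfold ofPath
  erw [Finsupp.linearCombination_single, one_smul, Finsupp.linearCombination_single, one_smul]
  simp [pathMul]
  rfl

theorem ofPath_mul_ofPath_of_ne {a b c d : V} (p : Quiver.Path a b) (q : Quiver.Path c d)
    (h : b ≠ c) : ofPath k p * ofPath k q = 0 := by
  rw [mul_def, mulMap]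
  unfold ofPath
  erw [Finsupp.linearCombination_single, one_smul, Finsupp.linearCombination_single, one_smul]
  simp [pathMul, h]

/-- A property closed under addition and scalars that holds for paths holds everywhere. -/
theorem path_induction {P : PathAlgebra k V → Prop} (x : PathAlgebra k V) (h0 : P 0)
    (hadd : ∀ x y, P x → P y → P (x + y))
    (hpath : ∀ (c : k) (a b : V) (p : Quiver.Path a b), P (c • ofPath k p)) : P x := by
  refine Finsupp.induction_linear (motive := P) x h0 hadd (fun p c => ?_)
  have := hpath c p.1 p.2.1 p.2.2
  unfold ofPath at this
  erw [Finsupp.smul_single, smul_eq_mul, mul_one] at this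
  exact this

theorem smul_mul' (c : k) (x y : PathAlgebra k V) : c • x * y = c • (x * y) := by
  simp [mul_def]

theorem mul_smul' (c : k) (x y : PathAlgebra k V) : x * c • y = c • (x * y) := by
  simp [mul_def]

theorem add_mul' (x y z : PathAlgebra k V) : (x + y) * z = x * z + y * z := by
  simp [mul_def]

theorem mul_add' (x y z : PathAlgebra k V) : x * (y + z) = x * y + x * z := by
  simp [mul_def]

theorem zero_mul' (x : PathAlgebra k V) : 0 * x = 0 := by simp [mul_def]

theorem mul_zero' (x : PathAlgebra k V) : x * 0 = 0 := by simp [mul_def]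

theorem mul_assoc' (x y z : PathAlgebra k V) : x * y * z = x * (y * z) := by
  induction x using path_induction with
  | h0 => simp [zero_mul']
  | hadd x x' h h' => simp [add_mul', h, h']
  | hpath c a b p =>
  induction y using path_induction with
  | h0 => simp [zero_mul', mul_zero']
  | hadd y y' h h' => simp [add_mul', mul_add', h, h']
  | hpath c' a' b' q =>
  induction z using path_induction with
  | h0 => simp [mul_zero']
  | hadd z z' h h' => simp [mul_add', h, h']
  | hpath c'' a'' b'' r =>
  simp only [smul_mul', mul_smul']
  congr 3
  by_cases h : b = a'
  · subst h
    by_cases h' : b' = a''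
    · subst h'
      simp [ofPath_mul_ofPath, Quiver.Path.comp_assoc]
    · simp [ofPath_mul_ofPath, ofPath_mul_ofPath_of_ne _ _ h', mul_zero']
  · by_cases h' : b' = a''
    · subst h'
      simp [ofPath_mul_ofPath, ofPath_mul_ofPath_of_ne _ _ h, zero_mul']
    · simp [ofPath_mul_ofPath_of_ne _ _ h, ofPath_mul_ofPath_of_ne _ _ h', zero_mul', mul_zero']

variable [Fintype V]

theorem one_def : (1 : PathAlgebra k V) =
    ∑ a : V, ofPath k (Quiver.Path.nil : Quiver.Path a a) := rfl

theorem one_mul' (x : PathAlgebra k V) : 1 * x = x := by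
  induction x using path_induction with
  | h0 => simp [mul_zero']
  | hadd x x' h h' => simp [mul_add', h, h']
  | hpath c a b p =>
  rw [mul_smul', one_def, mul_def, map_sum, LinearMap.sum_apply, Finset.sum_eq_single a]
  · rw [← mul_def, ofPath_mul_ofPath, Quiver.Path.nil_comp]
  · intro d _ hd
    rw [← mul_def, ofPath_mul_ofPath_of_ne _ _ hd]
  · simp

theorem mul_one' (x : PathAlgebra k V) : x * 1 = x := by
  induction x using path_induction with
  | h0 => simp [zero_mul']
  | hadd x x' h h' => simp [add_mul', h, h']
  | hpath c a b p =>
  rw [smul_mul', one_def, mul_def, map_sum, Finset.sum_eq_single b]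
  · rw [← mul_def, ofPath_mul_ofPath, Quiver.Path.comp_nil]
  · intro d _ hd
    rw [← mul_def, ofPath_mul_ofPath_of_ne _ _ hd.symm]
  · simp

instance : Ring (PathAlgebra k V) where
  zero_mul := zero_mul'
  mul_zero := mul_zero'
  left_distrib := mul_add'
  right_distrib := add_mul'
  mul_assoc := mul_assoc'
  one_mul := one_mul'
  mul_one := mul_one'
  zsmul := fun n x => n • x
  zsmul_zero' := fun x => zero_zsmul x
  zsmul_succ' := fun n x => SubNegMonoid.zsmul_succ' n x
  zsmul_neg' := fun n x => SubNegMonoid.zsmul_neg' n x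
  neg_add_cancel := neg_add_cancel
  sub_eq_add_neg := sub_eq_add_neg
  nsmul := fun n x => n • x
  nsmul_zero := fun x => zero_nsmul x
  nsmul_succ := fun n x => succ_nsmul x n

instance : Algebra k (PathAlgebra k V) := Algebra.ofModule smul_mul' mul_smul'

end PathAlgebra

/-! ## Toupie quivers and admissible ideals -/

/-- A quiver is toupie with source `o` and sink `t`: `o` is the only source, `t` is the only sink,
every other vertex is the source of exactly one arrow and the target of exactly one arrow, and the
quiver is connected with `o ≠ t`. -/
structure IsToupie {V : Type u} [Quiver.{v} V] (o t : V) : Prop where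
  isSource_iff : ∀ x : V, IsEmpty (Σ y : V, (y ⟶ x)) ↔ x = o
  isSink_iff : ∀ x : V, IsEmpty (Σ y : V, (x ⟶ y)) ↔ x = t
  existsUnique_out : ∀ x : V, x ≠ o → x ≠ t → ∃ α : Σ y : V, (x ⟶ y), ∀ β, β = α
  existsUnique_in : ∀ x : V, x ≠ o → x ≠ t → ∃ α : Σ y : V, (y ⟶ x), ∀ β, β = α
  source_ne_sink : o ≠ t
  connected : Subsingleton (Quiver.WeaklyConnectedComponent V)

section Relations

variable {k : Type w} {V : Type u} [Field k] [Quiver.{v} V] [Fintype V]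

/-- A two-sided ideal `I` of `kQ` is admissible: `R ^ m ⊆ I ⊆ R ^ 2` for some `m`, where `R ^ j` is
the span of the paths of length at least `j`. -/
def IsAdmissible (I : Ideal (PathAlgebra k V)) : Prop :=
  (I : Set (PathAlgebra k V)) ⊆
      Submodule.span k {x | ∃ (a b : V) (p : Quiver.Path a b), 2 ≤ p.length ∧ x = ofPath k p} ∧
    ∃ m : ℕ, ∀ (a b : V) (p : Quiver.Path a b), m ≤ p.length → ofPath k p ∈ I

/-- The monomial relations: the paths in `I` none of whose proper subpaths lies in `I`. -/
def IsMonomialRelation (I : Ideal (PathAlgebra k V)) {a b : V} (σ : Quiver.Path a b) : Prop :=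
  ofPath k σ ∈ I ∧ ∀ (c d : V) (x : Quiver.Path a c) (τ : Quiver.Path c d) (y : Quiver.Path d b),
    σ = (x.comp τ).comp y → ofPath k τ ∈ I → τ.length = σ.length

variable {o t : V} {N : ℕ}

/-- The `i`-th branch is an arrow from the source to the sink (it belongs to `Z`). -/
def IsArrowBranch (br : Fin N ≃ Quiver.Path o t) (i : Fin N) : Prop := (br i).length = 1

/-- The `i`-th branch contains a monomial relation. -/
def HasMonomial (I : Ideal (PathAlgebra k V)) (br : Fin N ≃ Quiver.Path o t) (i : Fin N) : Prop :=
  ∃ (a b : V) (x : Quiver.Path o a) (σ : Quiver.Path a b) (y : Quiver.Path b t),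
    IsMonomialRelation I σ ∧ br i = (x.comp σ).comp y

/-- The linear combination `∑ c_j α^(j)` of branches, in the path algebra. -/
def branchComb (br : Fin N ≃ Quiver.Path o t) : (Fin N → k) →ₗ[k] PathAlgebra k V :=
  Fintype.linearCombination k fun j => ofPath k (br j)

/-- Coefficient vectors of the linear combinations of branches that lie in `I`. -/
def relSpace (I : Ideal (PathAlgebra k V)) (br : Fin N ≃ Quiver.Path o t) :
    Submodule k (Fin N → k) :=
  (I.restrictScalars k).comap (branchComb br)

/-- `i` is a pivot column of the row space `W`. -/
def IsPivot (W : Submodule k (Fin N → k)) (i : Fin N) : Prop :=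
  ∃ c ∈ W, c i ≠ 0 ∧ ∀ j < i, c j = 0

/-- The nonzero rows of the reduced row echelon form of a matrix with row space `W`. -/
def echelonRows (W : Submodule k (Fin N → k)) : Set (Fin N → k) :=
  {c | c ∈ W ∧ ∃ i, c i = 1 ∧ (∀ j < i, c j = 0) ∧ ∀ j, j ≠ i → IsPivot W j → c j = 0}

/-- The non monomial relations `ρ = α^(i) + ∑_{j > i} b_j α^(j)`, as coefficient vectors: the rows
of the reduced row echelon form of all relations between branches that involve at least two
branches (a row with a single entry is a branch lying in `I`). -/
def nonMonomialRelations (I : Ideal (PathAlgebra k V)) (br : Fin N ≃ Quiver.Path o t) :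
    Set (Fin N → k) :=
  {c | c ∈ echelonRows (relSpace I br) ∧ ∃ i j, i ≠ j ∧ c i ≠ 0 ∧ c j ≠ 0}

/-- The minimal set of relations `𝓡`, monomial and non monomial, generating `I`. -/
def relations (I : Ideal (PathAlgebra k V)) (br : Fin N ≃ Quiver.Path o t) :
    Set (PathAlgebra k V) :=
  {r | ∃ (a b : V) (σ : Quiver.Path a b), IsMonomialRelation I σ ∧ r = ofPath k σ} ∪
    branchComb br '' nonMonomialRelations I br

/-- The branch `i` is irreducible, i.e. its class belongs to the monomial basis `𝓑` of `A`: it is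
not the leading branch of any element of `I`. -/
def IsIrreducibleBranch (I : Ideal (PathAlgebra k V)) (br : Fin N ≃ Quiver.Path o t)
    (i : Fin N) : Prop :=
  ¬ IsPivot (relSpace I br) i

/-- The vertices of the graph `Q_ρ`: branches that are not arrows and contain no monomial
relation. -/
abbrev QRhoVertex (I : Ideal (PathAlgebra k V)) (br : Fin N ≃ Quiver.Path o t) : Type :=
  {i : Fin N // ¬ IsArrowBranch br i ∧ ¬ HasMonomial I br i}

/-- The graph `Q_ρ`: two branches are joined if some non monomial relation involves both. -/
def QRho (I : Ideal (PathAlgebra k V)) (br : Fin N ≃ Quiver.Path o t) :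
    SimpleGraph (QRhoVertex I br) where
  Adj i j := i ≠ j ∧ ∃ c ∈ nonMonomialRelations I br, c i.1 ≠ 0 ∧ c j.1 ≠ 0
  symm := ⟨fun _ _ ⟨h, c, hc, h₁, h₂⟩ => ⟨h.symm, c, hc, h₂, h₁⟩⟩
  loopless := ⟨fun _ h => h.1 rfl⟩

end Relations

/-! ## Hochschild cohomology in degree one -/

section Hochschild

variable (k : Type*) (A : Type*) [Field k] [Ring A] [Algebra k A]

/-- The Hochschild differential `A → Hom_k(A, A)`, `a ↦ (x ↦ x a - a x)`. -/
def hochschildD0 : A →ₗ[k] A →ₗ[k] A := (LinearMap.mul k A).flip - LinearMap.mul k A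

/-- The Hochschild differential `Hom_k(A, A) → Hom_k(A ⊗ A, A)`,
`f ↦ (x ⊗ y ↦ x f(y) - f(x y) + f(x) y)`. -/
def hochschildD1 : (A →ₗ[k] A) →ₗ[k] A →ₗ[k] A →ₗ[k] A where
  toFun f := (LinearMap.mul k A).compl₂ f - (LinearMap.mul k A).compr₂ f +
    (LinearMap.mul k A).comp f
  map_add' f g := by
    ext x y
    simp [mul_add]
    abel
  map_smul' c f := by
    ext x y
    simp [smul_sub]

theorem hochschildD1_apply (f : A →ₗ[k] A) (x y : A) :
    hochschildD1 k A f x y = x * f y - f (x * y) + f x * y := rfl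

theorem hochschildD0_range_le : LinearMap.range (hochschildD0 k A) ≤
    LinearMap.ker (hochschildD1 k A) := by
  rintro _ ⟨a, rfl⟩
  rw [LinearMap.mem_ker]
  ext x y
  rw [hochschildD1_apply]
  simp [hochschildD0]
  noncomm_ring

/-- The Hochschild `1`-cocycles. -/
def cocycles1 : Submodule k (A →ₗ[k] A) := LinearMap.ker (hochschildD1 k A)

instance : AddCommGroup (cocycles1 k A) := (cocycles1 k A).addCommGroup

/-- The Hochschild `1`-coboundaries. -/
def coboundaries1 : Submodule k (A →ₗ[k] A) := LinearMap.range (hochschildD0 k A)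

/-- The first Hochschild cohomology space `HH^1(A)`. -/
abbrev HH1 : Type _ := cocycles1 k A ⧸ (coboundaries1 k A).submoduleOf (cocycles1 k A)

end Hochschild

/-! ## The complex `Hom_{E^e}(E, A) → Hom_{E^e}(kQ_1, A) → Hom_{E^e}(k𝓡, A)` -/

section Complex

variable {k : Type w} {V : Type u} [Field k] [Quiver.{v} V] [Fintype V]
  (I : Ideal (PathAlgebra k V)) [I.IsTwoSided]

/-- The class of a path in `A = kQ/I`. -/
def cls {a b : V} (p : Quiver.Path a b) : PathAlgebra k V ⧸ I :=
  Ideal.Quotient.mk I (ofPath k p)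

/-- The idempotent `e_x` of `A`. -/
def idem (x : V) : PathAlgebra k V ⧸ I := cls I (Quiver.Path.nil : Quiver.Path x x)

/-- The class of an arrow in `A`. -/
def arrowCls (α : Arrow V) : PathAlgebra k V ⧸ I := cls I α.2.2.toPath

/-- `Hom_{E^e}(E, A)`: families `c` of elements of `A` with `c x ∈ e_x A e_x`. -/
def homE : Submodule k (V → PathAlgebra k V ⧸ I) where
  carrier := {c | ∀ x, idem I x * c x * idem I x = c x}
  zero_mem' := by simp
  add_mem' := by
    intro c d hc hd x
    simp [mul_add, add_mul, hc x, hd x]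
  smul_mem' := by
    intro r c hc x
    simp [hc x]

/-- `Hom_{E^e}(kQ_1, A)`: families `f` of elements of `A` indexed by the arrows, with `f α` in
`e_x A e_y` for every arrow `α : x ⟶ y`. -/
def homArrows : Submodule k (Arrow V → PathAlgebra k V ⧸ I) where
  carrier := {f | ∀ α, idem I α.1 * f α * idem I α.2.1 = f α}
  zero_mem' := by simp
  add_mem' := by
    intro c d hc hd x
    simp [mul_add, add_mul, hc x, hd x]
  smul_mem' := by
    intro r c hc x
    simp [hc x]

/-- `(D_0 c)(α) = α c_y - c_x α` for `α : x ⟶ y`. -/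
def D0 : (V → PathAlgebra k V ⧸ I) →ₗ[k] (Arrow V → PathAlgebra k V ⧸ I) where
  toFun c α := arrowCls I α * c α.2.1 - c α.1 * arrowCls I α
  map_add' c d := by
    ext α
    simp [mul_add, add_mul]
    abel
  map_smul' r c := by
    ext α
    simp [smul_sub]

/-- For a path `p`, the sum of `p' f(α) p''` over all factorizations `p = p' α p''` with `α` an
arrow. -/
def substPath (f : Arrow V → PathAlgebra k V ⧸ I) {a : V} :
    ∀ {b : V}, Quiver.Path a b → PathAlgebra k V ⧸ I
  | _, Quiver.Path.nil => 0
  | _, @Quiver.Path.cons _ _ _ b c p α =>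
      substPath f p * arrowCls I ⟨b, c, α⟩ + cls I p * f ⟨b, c, α⟩

/-- The linear extension of `substPath` to the path algebra. -/
def subst (f : Arrow V → PathAlgebra k V ⧸ I) : PathAlgebra k V →ₗ[k] PathAlgebra k V ⧸ I :=
  Finsupp.linearCombination k (M := PathAlgebra k V ⧸ I) fun p : AnyPath V => substPath I f p.2.2

theorem subst_ofPath (f : Arrow V → PathAlgebra k V ⧸ I) {a b : V} (p : Quiver.Path a b) :
    subst I f (ofPath k p) = substPath I f p := by
  unfold subst ofPath
  erw [Finsupp.linearCombination_single, one_smul]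

theorem substPath_add (f g : Arrow V → PathAlgebra k V ⧸ I) {a b : V} (p : Quiver.Path a b) :
    substPath I (f + g) p = substPath I f p + substPath I g p := by
  induction p with
  | nil => simp [substPath]
  | cons p α ih =>
    simp [substPath, ih, mul_add, add_mul]
    abel

theorem substPath_smul (c : k) (f : Arrow V → PathAlgebra k V ⧸ I) {a b : V}
    (p : Quiver.Path a b) : substPath I (c • f) p = c • substPath I f p := by
  induction p with
  | nil => simp [substPath]
  | cons p α ih => simp [substPath, ih]

variable {o t : V} {N : ℕ} (br : Fin N ≃ Quiver.Path o t)

/-- `D_1`, with values in the families indexed by `𝓡`: `(D_1 f)(r) = ∑ r⁽¹⁾ f(r⁽²⁾) r⁽³⁾`. -/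
def D1 : (Arrow V → PathAlgebra k V ⧸ I) →ₗ[k] (relations I br → PathAlgebra k V ⧸ I) where
  toFun f r := subst I f r.1
  map_add' f g := by
    ext r
    simp only [Pi.add_apply]
    induction r.1 using path_induction with
    | h0 => simp
    | hadd x y hx hy =>
      rw [map_add, map_add, map_add, hx, hy]
      abel
    | hpath c a b p => simp [subst_ofPath, substPath_add]
  map_smul' c f := by
    ext r
    simp only [Pi.smul_apply, RingHom.id_apply]
    induction r.1 using path_induction with
    | h0 => simp
    | hadd x y hx hy => rw [map_add, map_add, hx, hy, smul_add]
    | hpath d a b p => simp [subst_ofPath, substPath_smul, smul_comm c d]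

/-- `Im D_0`, inside the families indexed by the arrows. -/
def imD0 : Submodule k (Arrow V → PathAlgebra k V ⧸ I) := (homE I).map (D0 I)

/-- `Ker D_1`, inside the families indexed by the arrows. -/
def kerD1 : Submodule k (Arrow V → PathAlgebra k V ⧸ I) :=
  homArrows I ⊓ LinearMap.ker (D1 I br)

/-- The cohomology `Ker D_1 / Im D_0`. -/
abbrev H1 : Type _ := kerD1 I br ⧸ (imD0 I).submoduleOf (kerD1 I br)

end Complex

/-! ## The sets `K` and `Û` -/

section Basis

variable {V : Type u} [Quiver.{v} V]

/-- The list of arrows of a path, in order. -/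
def arrows {a : V} : ∀ {b : V}, Quiver.Path a b → List (Arrow V)
  | _, Quiver.Path.nil => []
  | _, @Quiver.Path.cons _ _ _ b c p α => arrows p ++ [⟨b, c, α⟩]

variable {k : Type w} [Field k] [Fintype V] (I : Ideal (PathAlgebra k V)) [I.IsTwoSided]

open Classical in
/-- `α ∥ x`: the family with value `x` at the arrow `α` and `0` at the other arrows. -/
def par (α : Arrow V) (x : PathAlgebra k V ⧸ I) : Arrow V → PathAlgebra k V ⧸ I := Pi.single α x

variable {o t : V} {N : ℕ} (br : Fin N ≃ Quiver.Path o t)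

/-- `α^i_j ∥ α^i_j`, where `α^i_j` is the `j`-th arrow (counted from `0`) of the `i`-th branch. -/
def diag (i : Fin N) (j : ℕ) : Arrow V → PathAlgebra k V ⧸ I :=
  ((arrows (br i))[j]?).elim 0 fun α => par I α (arrowCls I α)

/-- `α^(p) ∥ α^(q)`, for a branch `α^(p)` that is an arrow and any branch `α^(q)`. -/
def branchPar (p q : Fin N) : Arrow V → PathAlgebra k V ⧸ I :=
  ((arrows (br p))[0]?).elim 0 fun α => par I α (cls I (br q))

/-- `s = ∑ α^i_0 ∥ α^i_0`, over all branches. -/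
def sElt : Arrow V → PathAlgebra k V ⧸ I := ∑ i : Fin N, diag I br i 0

open Classical in
/-- `t_κ = ∑ α^i_0 ∥ α^i_0`, over the branches in the connected component `κ` of `Q_ρ`. -/
def tElt (κ : (QRho I br).ConnectedComponent) : Arrow V → PathAlgebra k V ⧸ I :=
  ∑ i : QRhoVertex I br, if (QRho I br).connectedComponentMk i = κ then diag I br i.1 0 else 0

/-- `C_1'`: the elements `α^i_j ∥ α^i_j - α^i_0 ∥ α^i_0`, `j ≠ 0`, for the branches that contain
a monomial relation. -/
def setC1' : Set (Arrow V → PathAlgebra k V ⧸ I) :=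
  {f | ∃ (i : Fin N) (j : ℕ), HasMonomial I br i ∧ 0 < j ∧ j < (br i).length ∧
    f = diag I br i j - diag I br i 0}

/-- `C_1''`: the elements `y_i`. -/
def setY : Set (Arrow V → PathAlgebra k V ⧸ I) :=
  {f | ∃ i : Fin N, HasMonomial I br i ∧ f = diag I br i 0}

/-- The elements `w_pq`. -/
def setW : Set (Arrow V → PathAlgebra k V ⧸ I) :=
  {f | ∃ p q : Fin N, IsArrowBranch br p ∧ IsArrowBranch br q ∧ p ≠ q ∧ f = branchPar I br p q}

/-- The elements `z_us`. -/
def setZ : Set (Arrow V → PathAlgebra k V ⧸ I) :=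
  {f | ∃ p q : Fin N, IsArrowBranch br p ∧ ¬ IsArrowBranch br q ∧ IsIrreducibleBranch I br q ∧
    f = branchPar I br p q}

/-- The elements `x_j = α^(j) ∥ α^(j) - α^(1) ∥ α^(1)`, where `α^(1)` is the first of the branches
that are arrows and `α^(j)` is another one. -/
def setX : Set (Arrow V → PathAlgebra k V ⧸ I) :=
  {f | ∃ i j : Fin N, IsArrowBranch br i ∧ (∀ l, IsArrowBranch br l → i ≤ l) ∧
    IsArrowBranch br j ∧ j ≠ i ∧ f = branchPar I br j j - branchPar I br i i}

/-- `C_3`: the elements `α^i_j ∥ α^i_j - α^i_0 ∥ α^i_0`, `j ≠ 0`, for the branches of length at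
least `2` that contain no monomial relation. -/
def setC3 : Set (Arrow V → PathAlgebra k V ⧸ I) :=
  {f | ∃ (i : Fin N) (j : ℕ), ¬ HasMonomial I br i ∧ 1 < (br i).length ∧ 0 < j ∧
    j < (br i).length ∧ f = diag I br i j - diag I br i 0}

/-- `C_4`: the elements `t_k`. -/
def setT : Set (Arrow V → PathAlgebra k V ⧸ I) := Set.range (tElt I br)

/-- When no branch is an arrow: the (unique) element of `C_1 ∪ C_4` in which `α^B_0 ∥ α^B_0`
appears, `α^(B)` being the last branch. -/
def setLast : Set (Arrow V → PathAlgebra k V ⧸ I) :=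
  {f | ∃ B : Fin N, (∀ i, i ≤ B) ∧ ((HasMonomial I br B ∧ f = diag I br B 0) ∨
    ∃ h : ¬ IsArrowBranch br B ∧ ¬ HasMonomial I br B,
      f = tElt I br ((QRho I br).connectedComponentMk ⟨B, h⟩))}

/-- `K = {s} ∪ C_1' ∪ C_3`. -/
def setK : Set (Arrow V → PathAlgebra k V ⧸ I) := {sElt I br} ∪ setC1' I br ∪ setC3 I br

open Classical in
/-- `Û`. If some branch is an arrow, `C_2 = Z ∥ ₀𝓑_ω` is replaced by the `w_pq`, the `z_us`, the
`x_j` and `s`; otherwise `s` replaces the element of `C_1 ∪ C_4` that involves the last branch. -/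
def setUhat : Set (Arrow V → PathAlgebra k V ⧸ I) :=
  if ∃ i, IsArrowBranch br i then
    setC1' I br ∪ setY I br ∪ (setW I br ∪ setZ I br ∪ setX I br ∪ {sElt I br}) ∪ setC3 I br ∪
      setT I br
  else
    ((setC1' I br ∪ setY I br ∪ setC3 I br ∪ setT I br) \ setLast I br) ∪ {sElt I br}

end Basis

end Toupie

end

open Toupie

noncomputable section
namespace Toupie

/-! ## Paths of a toupie quiver -/

section Paths

open Quiver (Path)

variable {V : Type u} [Quiver.{v} V] {o t : V}

namespace IsToupie

/-! The shape of the quiver decides everything: outside the source every path is forced, so parallel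
paths coincide unless they are branches (`path_unique`). Hence $e_xAe_x=k\,e_x$, the corner of an
arrow $x\to y$ with $(x,y)\ne(0,\omega)$ is spanned by that arrow, and only $e_0Ae_\omega$ is
larger; the irreducible branches form a basis of it.

Cutting an element of $I$ into corners shows that $\mathcal R$ generates $I$. So a family killed by
$D_1$ extends, by the Leibniz rule, to a derivation of $A$ vanishing on the vertices. Every
derivation becomes one of these after subtracting an inner derivation, and the inner ones among them
come from $\mathrm{Im}\,D_0$. This is the comparison with $HH^1(A)$ (`ker_toHH1`,
`toHH1_surjective`).

By `mem_imD0_iff`, $\mathrm{Im}\,D_0$ consists of the coboundaries of functions on the vertices.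
Modulo them a cocycle can be made to vanish off the arrows leaving the source (`exists_potential`),
which are the first arrows of the branches. It then multiplies each branch that is not an arrow by a
scalar. By `mem_kerD1_iff` the only condition is that these scalars agree on the branches of a
common non monomial relation, that is, on the components of $Q_\rho$; values at branches that are
arrows are free, because admissible relations do not involve arrows. So the $y_i$, the $t_k$ and the
$\alpha^{(p)}\|\alpha^{(q)}$ with $p\in Z$, $q$ irreducible, generate the cohomology
(`exists_sub_genComb_mem`).

A combination of them is a coboundary only if its potential is constant outside the source, so every
relation is a multiple of the single relation $s=0$ (`exists_eq_smul_sVec`). One generator can thus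
be discarded, after subtracting multiples of it from the others, provided one scalar is nonzero
(`linearIndependent_sub_smul`). If $a=0$ the scalar is $1$; if $a>0$ it is $a$, whence
characteristic $0$. Finally $K\subseteq\mathrm{Im}\,D_0$ contains no basis element, so deleting $K$
from $\widehat U$ leaves exactly the basis. -/

theorem no_arrow_to_source (hQ : IsToupie o t) {x : V} (α : x ⟶ o) : False :=
  ((hQ.isSource_iff o).2 rfl).false ⟨x, α⟩

theorem no_arrow_from_sink (hQ : IsToupie o t) {x : V} (α : t ⟶ x) : False :=
  ((hQ.isSink_iff t).2 rfl).false ⟨x, α⟩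

theorem ne_source_of_arrow (hQ : IsToupie o t) {x y : V} (α : x ⟶ y) : y ≠ o := by
  rintro rfl
  exact hQ.no_arrow_to_source α

theorem ne_sink_of_arrow (hQ : IsToupie o t) {x y : V} (α : x ⟶ y) : x ≠ t := by
  rintro rfl
  exact hQ.no_arrow_from_sink α

theorem out_unique (hQ : IsToupie o t) {x y z : V} (hx : x ≠ o) (α : x ⟶ y) (β : x ⟶ z) :
    (⟨y, α⟩ : Σ y : V, (x ⟶ y)) = ⟨z, β⟩ := by
  obtain ⟨γ, h⟩ := hQ.existsUnique_out x hx (hQ.ne_sink_of_arrow α)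
  rw [h ⟨y, α⟩, h ⟨z, β⟩]

theorem in_unique (hQ : IsToupie o t) {x y z : V} (hx : x ≠ t) (α : y ⟶ x) (β : z ⟶ x) :
    (⟨y, α⟩ : Σ y : V, (y ⟶ x)) = ⟨z, β⟩ := by
  obtain ⟨γ, h⟩ := hQ.existsUnique_in x (hQ.ne_source_of_arrow α) hx
  rw [h ⟨y, α⟩, h ⟨z, β⟩]

theorem eq_source_of_path (hQ : IsToupie o t) {a : V} (p : Path a o) : a = o := by
  cases p with
  | nil => rfl
  | cons p α => exact (hQ.no_arrow_to_source α).elim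

theorem path_source_source (hQ : IsToupie o t) (p : Path o o) : p = Path.nil := by
  cases p with
  | nil => rfl
  | cons p α => exact (hQ.no_arrow_to_source α).elim

theorem eq_sink_of_path (hQ : IsToupie o t) {a : V} (p : Path t a) : a = t := by
  induction p with
  | nil => rfl
  | cons p α ih =>
    subst ih
    exact (hQ.no_arrow_from_sink α).elim

theorem path_sink_sink (hQ : IsToupie o t) (p : Path t t) : p = Path.nil := by
  cases p with
  | nil => rfl
  | cons p α =>
    obtain rfl := hQ.eq_sink_of_path p
    exact (hQ.no_arrow_from_sink α).elim

theorem ne_source_of_path (hQ : IsToupie o t) {a b : V} (ha : a ≠ o) (p : Path a b) : b ≠ o := by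
  rintro rfl
  exact ha (hQ.eq_source_of_path p)

/-- The vertices reachable from a vertex that does not reach the sink are closed under
predecessors, so that they form a connected component. -/
theorem nonempty_path_sink [Finite V] (hQ : IsToupie o t) (a : V) : Nonempty (Path a t) := by
  have main : ∀ x : V, x ≠ o → Nonempty (Path x t) := by
    intro x hx
    by_contra hxt
    let S : Set V := {y | Nonempty (Path x y)}
    have hS : ∀ y ∈ S, y ≠ o ∧ y ≠ t := by
      rintro y ⟨p⟩
      refine ⟨hQ.ne_source_of_path hx p, ?_⟩
      rintro rfl
      exact hxt ⟨p⟩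
    have hex : ∀ y : S, ∃ z : S, Nonempty (y.1 ⟶ z.1) := by
      rintro ⟨y, hy⟩
      obtain ⟨⟨z, α⟩, _⟩ := hQ.existsUnique_out y (hS y hy).1 (hS y hy).2
      obtain ⟨p⟩ := hy
      exact ⟨⟨z, ⟨p.cons α⟩⟩, ⟨α⟩⟩
    choose succ hsucc using hex
    -- A vertex other than the sink has only one incoming arrow. By finiteness the successor map on
    -- `S` is then onto, so the arrow entering a vertex of `S` starts in `S`.
    have hinj : Function.Injective succ := by
      intro y z h
      obtain ⟨α⟩ := hsucc y
      obtain ⟨β⟩ := hsucc z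
      rw [← h] at β
      exact Subtype.ext (congrArg Sigma.fst (hQ.in_unique (hS _ (succ y).2).2 α β))
    have hsurj := Finite.surjective_of_injective hinj
    have hpred : ∀ {y z : V} (_ : y ⟶ z), z ∈ S → y ∈ S := by
      intro y z α hz
      obtain ⟨y', hy'⟩ := hsurj ⟨z, hz⟩
      obtain ⟨β⟩ := hsucc y'
      rw [hy'] at β
      have := congrArg Sigma.fst (hQ.in_unique (hS z hz).2 α β)
      simp only at this
      rw [this]
      exact y'.2
    have hclosed : ∀ b : V, ∀ _ : @Path (Quiver.Symmetrify V) _ x b, b ∈ S := by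
      intro b p
      induction p with
      | nil => exact ⟨Path.nil⟩
      | cons p α ih =>
        rcases α with α | α
        · obtain ⟨q⟩ := ih
          exact ⟨q.cons α⟩
        · exact hpred α ih
    have := hQ.connected
    obtain ⟨p⟩ := (Quiver.WeaklyConnectedComponent.eq x t).1 (Subsingleton.elim _ _)
    exact (hS t (hclosed t p)).2 rfl
  by_cases ha : a = o
  · subst ha
    have h := (not_congr (hQ.isSink_iff a)).2 hQ.source_ne_sink
    rw [not_isEmpty_iff] at h
    obtain ⟨y, α⟩ := h
    obtain ⟨p⟩ := main y (hQ.ne_source_of_arrow α)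
    exact ⟨α.toPath.comp p⟩
  · exact main a ha

/-- Outside the source, every path is an initial segment of every path to the sink. -/
theorem exists_comp_eq (hQ : IsToupie o t) {a b : V} (ha : a ≠ o) (q : Path a t)
    (p : Path a b) : ∃ r : Path b t, q = p.comp r := by
  induction p with
  | nil => exact ⟨q, (Path.nil_comp q).symm⟩
  | @cons b c p α ih =>
    obtain ⟨r, hr⟩ := ih
    have hl : r.length ≠ 0 := by
      intro h
      obtain rfl := Path.eq_of_length_zero r h
      exact hQ.no_arrow_from_sink α
    obtain ⟨d, β, r', -, rfl⟩ := Path.eq_toPath_comp_of_length_eq_succ r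
      (Nat.succ_pred_eq_of_ne_zero hl).symm
    -- Both arrows leave the same vertex, which is not the source.
    cases hQ.out_unique (hQ.ne_source_of_path ha p) α β
    refine ⟨r', ?_⟩
    rw [hr, ← Path.comp_assoc, Path.comp_toPath_eq_cons]

theorem path_to_sink_unique (hQ : IsToupie o t) {a : V} (ha : a ≠ o) (p q : Path a t) :
    p = q := by
  obtain ⟨r, hr⟩ := hQ.exists_comp_eq ha q p
  rw [hr, hQ.path_sink_sink r, Path.comp_nil]

theorem path_unique_of_ne_source [Finite V] (hQ : IsToupie o t) {a b : V} (ha : a ≠ o)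
    (p q : Path a b) : p = q := by
  obtain ⟨r⟩ := hQ.nonempty_path_sink b
  exact Path.comp_inj_left.1 (hQ.path_to_sink_unique ha (p.comp r) (q.comp r))

theorem path_from_source_unique (hQ : IsToupie o t) {b : V} (hb : b ≠ t) (p q : Path o b) :
    p = q := by
  induction p with
  | nil => exact (hQ.path_source_source q).symm
  | @cons b c p α ih =>
    cases q with
    | nil => exact (hQ.no_arrow_to_source α).elim
    | cons q β =>
      cases hQ.in_unique hb α β
      rw [ih (hQ.ne_sink_of_arrow α) q]

/-- Two parallel paths coincide, unless they are branches. -/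
theorem path_unique [Finite V] (hQ : IsToupie o t) {a b : V} (h : a = o → b ≠ t)
    (p q : Path a b) : p = q := by
  by_cases ha : a = o
  · subst ha
    exact hQ.path_from_source_unique (h rfl) p q
  · exact hQ.path_unique_of_ne_source ha p q

theorem closed_path_eq_nil [Finite V] (hQ : IsToupie o t) {a : V} (p : Path a a) :
    p = Path.nil :=
  hQ.path_unique (fun h h' => hQ.source_ne_sink (h.symm.trans h')) p _

theorem exists_first_arrow (hQ : IsToupie o t) (p : Path o t) :
    ∃ (y : V) (α : o ⟶ y) (r : Path y t), p = α.toPath.comp r := by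
  have hl : p.length ≠ 0 := fun h => hQ.source_ne_sink (Path.eq_of_length_zero p h)
  obtain ⟨y, α, r, -, h⟩ := Path.eq_toPath_comp_of_length_eq_succ p
      (Nat.succ_pred_eq_of_ne_zero hl).symm
  exact ⟨y, α, r, h⟩

end IsToupie

/-! ### Arrows of a path, and branches split after their first arrow -/

theorem arrows_comp {a b c : V} (p : Path a b) (q : Path b c) :
    arrows (p.comp q) = arrows p ++ arrows q := by
  induction q with
  | nil => simp [arrows]
  | cons q α ih => simp [arrows, ih]

theorem arrows_toPath_comp {a b c : V} (α : a ⟶ b) (q : Path b c) :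
    arrows (α.toPath.comp q) = ⟨a, b, α⟩ :: arrows q := by
  rw [arrows_comp]
  rfl

theorem length_arrows {a b : V} (p : Path a b) : (arrows p).length = p.length := by
  induction p with
  | nil => rfl
  | cons p α ih => simp [arrows, ih]

variable {N : ℕ} (br : Fin N ≃ Path o t)

/-- The target of the first arrow of a branch. -/
def headVertex (hQ : IsToupie o t) (i : Fin N) : V := (hQ.exists_first_arrow (br i)).choose

/-- The first arrow of a branch, as a morphism. -/
def headArrow (hQ : IsToupie o t) (i : Fin N) : o ⟶ headVertex br hQ i :=
  (hQ.exists_first_arrow (br i)).choose_spec.choose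

/-- The first arrow of a branch. -/
def firstArrow (hQ : IsToupie o t) (i : Fin N) : Arrow V :=
  ⟨o, headVertex br hQ i, headArrow br hQ i⟩

/-- The part of a branch after its first arrow. -/
def branchTail (hQ : IsToupie o t) (i : Fin N) : Path (headVertex br hQ i) t :=
  (hQ.exists_first_arrow (br i)).choose_spec.choose_spec.choose

theorem branch_eq (hQ : IsToupie o t) (i : Fin N) :
    br i = (headArrow br hQ i).toPath.comp (branchTail br hQ i) :=
  (hQ.exists_first_arrow (br i)).choose_spec.choose_spec.choose_spec

theorem arrows_branch (hQ : IsToupie o t) (i : Fin N) :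
    arrows (br i) = firstArrow br hQ i :: arrows (branchTail br hQ i) := by
  rw [branch_eq br hQ i, arrows_toPath_comp]
  rfl

theorem firstArrow_eq (hQ : IsToupie o t) (i : Fin N) {y : V} (α : o ⟶ y) (r : Path y t)
    (h : br i = α.toPath.comp r) : firstArrow br hQ i = ⟨o, y, α⟩ := by
  have h₁ := arrows_branch br hQ i
  rw [h, arrows_toPath_comp] at h₁
  exact (List.cons.inj h₁).1.symm

theorem IsToupie.toPath_comp_eq (hQ : IsToupie o t) {y z : V} {α : o ⟶ y} {β : o ⟶ z}
    (h : (⟨o, y, α⟩ : Arrow V) = ⟨o, z, β⟩) (p : Path y t) (q : Path z t) :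
    α.toPath.comp p = β.toPath.comp q := by
  cases h
  rw [hQ.path_to_sink_unique (hQ.ne_source_of_arrow α) p q]

/-- After its first arrow a branch has no choice left. Together with `exists_firstArrow_eq`, this
identifies the branches with the arrows leaving the source. -/
theorem firstArrow_injective (hQ : IsToupie o t) : Function.Injective (firstArrow br hQ) := by
  intro i j h
  apply br.injective
  rw [branch_eq br hQ i, branch_eq br hQ j]
  exact hQ.toPath_comp_eq h _ _

theorem exists_firstArrow_eq [Finite V] (hQ : IsToupie o t) {y : V} (α : o ⟶ y) :
    ∃ i, firstArrow br hQ i = ⟨o, y, α⟩ := by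
  obtain ⟨r⟩ := hQ.nonempty_path_sink y
  exact ⟨br.symm (α.toPath.comp r), firstArrow_eq br hQ _ α r (br.apply_symm_apply _)⟩

theorem length_branch (hQ : IsToupie o t) (i : Fin N) :
    (br i).length = (branchTail br hQ i).length + 1 := by
  rw [branch_eq br hQ i, Path.length_comp, Quiver.Path.length_toPath, add_comm]

theorem isArrowBranch_iff (hQ : IsToupie o t) (i : Fin N) :
    IsArrowBranch br i ↔ headVertex br hQ i = t := by
  unfold IsArrowBranch
  rw [length_branch br hQ i]
  constructor
  · intro h
    exact Path.eq_of_length_zero (branchTail br hQ i) (by omega)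
  · intro h
    generalize branchTail br hQ i = p
    generalize headVertex br hQ i = y at h p
    subst h
    rw [hQ.path_sink_sink p]
    rfl

theorem exists_toPath_of_isArrowBranch {i : Fin N} (h : IsArrowBranch br i) :
    ∃ α : o ⟶ t, br i = α.toPath := by
  unfold IsArrowBranch at h
  generalize br i = p at h
  cases p with
  | nil => simp at h
  | cons p α =>
    rw [Path.length_cons] at h
    obtain rfl := Path.eq_of_length_zero p (by omega)
    exact ⟨α, by rw [Path.eq_nil_of_length_zero p (by omega)]; rfl⟩

end Paths

/-! ## Reduced row echelon forms -/

section Echelon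

variable {k : Type w} [Field k] {N : ℕ} (W : Submodule k (Fin N → k))

variable {W} in
-- The first nonzero entry of a vector of `W` sits at a pivot, so the pivot entries determine the
-- vector. Every comparison of rows below uses this.
theorem eq_zero_of_forall_pivot {c : Fin N → k} (hc : c ∈ W) (h : ∀ i, IsPivot W i → c i = 0) :
    c = 0 := by
  funext i
  induction i using WellFoundedLT.induction with
  | ind i ih =>
    by_contra hi
    exact hi (h i ⟨c, hc, hi, ih⟩)

/-- Every vector is congruent modulo `W` to one that vanishes at the pivots. -/
theorem exists_mem_forall_pivot_eq (v : Fin N → k) :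
    ∃ c ∈ W, ∀ i, IsPivot W i → c i = v i := by
  suffices h : ∀ n ≤ N, ∃ c ∈ W, ∀ i : Fin N, i.1 < n → IsPivot W i → c i = v i by
    obtain ⟨c, hc, h⟩ := h N le_rfl
    exact ⟨c, hc, fun i => h i i.2⟩
  intro n
  induction n with
  | zero => exact fun _ => ⟨0, W.zero_mem, fun i hi => absurd hi (Nat.not_lt_zero _)⟩
  | succ n ih =>
    intro hn
    obtain ⟨c, hc, h⟩ := ih (by omega)
    by_cases hp : IsPivot W ⟨n, hn⟩
    · obtain ⟨d, hd, hd0, hdl⟩ := hp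
      -- The vector `d` vanishes before `n`, so the entries already corrected do not change.
      refine ⟨c + ((v ⟨n, hn⟩ - c ⟨n, hn⟩) / d ⟨n, hn⟩) • d,
        W.add_mem hc (W.smul_mem _ hd), fun i hi hpi => ?_⟩
      simp only [Pi.add_apply, Pi.smul_apply, smul_eq_mul]
      rcases Nat.lt_succ_iff_lt_or_eq.1 hi with hi | hi
      · rw [hdl i hi, mul_zero, add_zero, h i hi hpi]
      · obtain rfl : i = ⟨n, hn⟩ := Fin.ext hi
        field_simp
        ring
    · refine ⟨c, hc, fun i hi hpi => ?_⟩
      rcases Nat.lt_succ_iff_lt_or_eq.1 hi with hi | hi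
      · exact h i hi hpi
      · obtain rfl : i = ⟨n, hn⟩ := Fin.ext hi
        exact absurd hpi hp

variable {W}

/-- The row of the reduced row echelon form that belongs to a pivot. -/
theorem exists_echelonRow {i : Fin N} (hi : IsPivot W i) :
    ∃ c ∈ W, c i = 1 ∧ (∀ j < i, c j = 0) ∧ ∀ j, j ≠ i → IsPivot W j → c j = 0 := by
  obtain ⟨c, hc, h⟩ := exists_mem_forall_pivot_eq W (Pi.single i 1)
  refine ⟨c, hc, by rw [h i hi, Pi.single_eq_same], fun j => ?_, fun j hj hp => by
    rw [h j hp, Pi.single_eq_of_ne hj]⟩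
  induction j using WellFoundedLT.induction with
  | ind j ih =>
    intro hj
    by_contra hne
    -- A first nonzero entry before `i` would itself be at a pivot, where `c` agrees with the unit
    -- vector at `i`.
    have hp : IsPivot W j := ⟨c, hc, hne, fun l hl => ih l hl (hl.trans hj)⟩
    exact hne (by rw [h j hp, Pi.single_eq_of_ne hj.ne])

theorem span_echelonRows : Submodule.span k (echelonRows W) = W := by
  classical
  apply le_antisymm (Submodule.span_le.2 fun c hc => hc.1)
  intro c hc
  have hex : ∀ i, ∃ r ∈ Submodule.span k (echelonRows W),
      r ∈ W ∧ ∀ j, IsPivot W j → r j = if j = i then 1 else 0 := by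
    intro i
    by_cases hi : IsPivot W i
    · obtain ⟨r, hr, h1, h2, h3⟩ := exists_echelonRow hi
      refine ⟨r, Submodule.subset_span ⟨hr, i, h1, h2, h3⟩, hr, fun j hj => ?_⟩
      split_ifs with h
      · rw [h, h1]
      · exact h3 j h hj
    -- The row `0` at a column that is not a pivot lets the sum below run over all columns.
    · refine ⟨0, Submodule.zero_mem _, W.zero_mem, fun j hj => ?_⟩
      rw [if_neg]
      · rfl
      · rintro rfl
        exact hi hj
  choose r hr hrW hrp using hex
  have : c - ∑ i, c i • r i = 0 := by
    refine eq_zero_of_forall_pivot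
      (W.sub_mem hc (W.sum_mem fun i _ => W.smul_mem _ (hrW i))) fun j hj => ?_
    simp [Finset.sum_apply, hrp _ j hj]
  rw [sub_eq_zero.1 this]
  exact Submodule.sum_mem _ fun i _ => Submodule.smul_mem _ _ (hr i)

/-- The entries of a row of the reduced row echelon form can be rescaled to give an element of
the row space only by a common factor. -/
theorem eq_of_mul_mem_of_mem_echelonRows {c l : Fin N → k} (hc : c ∈ echelonRows W)
    (hl : (fun i => c i * l i) ∈ W) {i j : Fin N} (hi : c i ≠ 0) (hj : c j ≠ 0) : l i = l j := by
  obtain ⟨hcW, m, h1, -, h3⟩ := hc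
  -- Here `m` is the pivot of the row: there `c m = 1` and the two terms cancel, while at the other
  -- pivots `c` vanishes.
  have key : (fun i => c i * l i) - l m • c = 0 := by
    refine eq_zero_of_forall_pivot (W.sub_mem hl (W.smul_mem _ hcW)) fun p hp => ?_
    by_cases hpm : p = m
    · subst hpm
      simp [h1]
    · simp [h3 p hpm hp]
  have aux : ∀ p, c p ≠ 0 → l p = l m := by
    intro p hp
    have := congrFun key p
    simp only [Pi.sub_apply, Pi.smul_apply, smul_eq_mul, Pi.zero_apply] at this
    have h : c p * (l p - l m) = 0 := by linear_combination this
    exact sub_eq_zero.1 ((mul_eq_zero.1 h).resolve_left hp)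
  rw [aux i hi, aux j hj]

end Echelon


/-! ## Cocycles and derivations -/

section Derivations

open Quiver (Path)

variable {k : Type w} {V : Type u} [Field k] [Quiver.{v} V] [Fintype V]

section Relations

variable {I : Ideal (PathAlgebra k V)} {o t : V} {N : ℕ} (br : Fin N ≃ Path o t)

theorem branchComb_apply (c : Fin N → k) : branchComb br c = ∑ i, c i • ofPath k (br i) := rfl

theorem branchComb_mem {c : Fin N → k} (hc : c ∈ relSpace I br) : branchComb br c ∈ I := hc

theorem relations_subset {r : PathAlgebra k V} (hr : r ∈ relations I br) : r ∈ I := by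
  rcases hr with ⟨a, b, σ, hσ, rfl⟩ | ⟨c, hc, rfl⟩
  · exact hσ.1
  · exact hc.1.1

end Relations

/-! ### Classes of paths, corners of the quotient and the Leibniz rule -/

section Quotient

variable (I : Ideal (PathAlgebra k V)) [I.IsTwoSided]

theorem cls_comp {a b c : V} (p : Path a b) (q : Path b c) :
    cls I (p.comp q) = cls I p * cls I q := by
  unfold cls
  rw [← map_mul, ofPath_mul_ofPath]

theorem cls_mul_cls_of_ne {a b c d : V} (p : Path a b) (q : Path c d) (h : b ≠ c) :
    cls I p * cls I q = 0 := by
  unfold cls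
  rw [← map_mul, ofPath_mul_ofPath_of_ne _ _ h, map_zero]

theorem cls_eq_zero_iff {a b : V} (p : Path a b) : cls I p = 0 ↔ ofPath k p ∈ I :=
  Ideal.Quotient.eq_zero_iff_mem

theorem idem_mul_cls {a b : V} (p : Path a b) : idem I a * cls I p = cls I p := by
  rw [idem, ← cls_comp, Path.nil_comp]

theorem cls_mul_idem {a b : V} (p : Path a b) : cls I p * idem I b = cls I p := by
  rw [idem, ← cls_comp, Path.comp_nil]

theorem idem_mul_idem (a : V) : idem I a * idem I a = idem I a := idem_mul_cls I _

theorem idem_mul_idem_of_ne {a b : V} (h : a ≠ b) : idem I a * idem I b = 0 :=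
  cls_mul_cls_of_ne I _ _ h

theorem sum_idem : ∑ a : V, idem I a = 1 := by
  unfold idem cls
  rw [← map_sum, ← one_def, map_one]

theorem mk_smul (c : k) (x : PathAlgebra k V) :
    Ideal.Quotient.mk I (c • x) = c • Ideal.Quotient.mk I x := rfl

theorem corner_mem_span (a b : V) (x : PathAlgebra k V) :
    ofPath k (Path.nil : Path a a) * x * ofPath k (Path.nil : Path b b) ∈
      Submodule.span k (Set.range fun p : Path a b => ofPath k p) := by
  induction x using path_induction with
  | h0 => simp
  | hadd x y hx hy =>
    rw [mul_add, add_mul]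
    exact Submodule.add_mem _ hx hy
  | hpath c a' b' p =>
    rw [mul_smul', smul_mul']
    refine Submodule.smul_mem _ _ ?_
    by_cases ha : a = a'
    · subst ha
      by_cases hb : b' = b
      · subst hb
        rw [ofPath_mul_ofPath, ofPath_mul_ofPath, Path.comp_nil, Path.nil_comp]
        exact Submodule.subset_span ⟨p, rfl⟩
      · rw [ofPath_mul_ofPath, ofPath_mul_ofPath_of_ne _ _ hb]
        exact Submodule.zero_mem _
    · rw [ofPath_mul_ofPath_of_ne _ _ ha, zero_mul]
      exact Submodule.zero_mem _

theorem corner_cls_mem_span (a b : V) (x : PathAlgebra k V ⧸ I) :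
    idem I a * x * idem I b ∈ Submodule.span k (Set.range fun p : Path a b => cls I p) := by
  obtain ⟨x, rfl⟩ := Ideal.Quotient.mk_surjective x
  have h := Submodule.mem_map_of_mem (f := (Ideal.Quotient.mkₐ k I).toLinearMap)
    (corner_mem_span a b x)
  rw [Submodule.map_span, ← Set.range_comp] at h
  exact h

theorem eq_sum_corner (x : PathAlgebra k V) :
    x = ∑ a : V, ∑ b : V,
      ofPath k (Path.nil : Path a a) * x * ofPath k (Path.nil : Path b b) := by
  conv_lhs => rw [← one_mul x, ← mul_one (1 * x), one_def]
  simp_rw [Finset.sum_mul, Finset.mul_sum]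

theorem subst_add (f g : Arrow V → PathAlgebra k V ⧸ I) (x : PathAlgebra k V) :
    subst I (f + g) x = subst I f x + subst I g x := by
  induction x using path_induction with
  | h0 => simp
  | hadd x y hx hy =>
    rw [map_add, map_add, map_add, hx, hy]
    abel
  | hpath c a b p => simp [subst_ofPath, substPath_add]

theorem subst_smul (c : k) (f : Arrow V → PathAlgebra k V ⧸ I) (x : PathAlgebra k V) :
    subst I (c • f) x = c • subst I f x := by
  induction x using path_induction with
  | h0 => simp
  | hadd x y hx hy => rw [map_add, map_add, hx, hy, smul_add]
  | hpath d a b p => simp [subst_ofPath, substPath_smul, smul_comm c d]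

variable {I}

theorem idem_mul_of_mem_homArrows {f : Arrow V → PathAlgebra k V ⧸ I} (hf : f ∈ homArrows I)
    (α : Arrow V) : idem I α.1 * f α = f α := by
  rw [← hf α, ← mul_assoc, ← mul_assoc, idem_mul_idem]

theorem mul_idem_of_mem_homArrows {f : Arrow V → PathAlgebra k V ⧸ I} (hf : f ∈ homArrows I)
    (α : Arrow V) : f α * idem I α.2.1 = f α := by
  rw [← hf α, mul_assoc, idem_mul_idem]

section Subst

variable {f : Arrow V → PathAlgebra k V ⧸ I}

theorem substPath_mul_idem (hf : f ∈ homArrows I) {a b : V} (p : Path a b) :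
    substPath I f p * idem I b = substPath I f p := by
  cases p with
  | nil => simp [substPath]
  | cons p α =>
    rw [substPath, add_mul, mul_assoc, mul_assoc, mul_idem_of_mem_homArrows hf ⟨_, _, α⟩, arrowCls,
      cls_mul_idem]

theorem idem_mul_substPath (f : Arrow V → PathAlgebra k V ⧸ I) {a b : V} (p : Path a b) :
    idem I a * substPath I f p = substPath I f p := by
  induction p with
  | nil => simp [substPath]
  | cons p α ih => rw [substPath, mul_add, ← mul_assoc, ← mul_assoc, ih, idem_mul_cls]

/-- The arrow replaced lies either in `p` or in `q`. Membership in `homArrows` makes the formula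
hold for trivial `q`, where it says that the value at `p` ends at `b`. -/
theorem substPath_comp (hf : f ∈ homArrows I) {a b c : V} (p : Path a b) (q : Path b c) :
    substPath I f (p.comp q) = substPath I f p * cls I q + cls I p * substPath I f q := by
  induction q with
  | nil =>
    change substPath I f p = substPath I f p * idem I b + cls I p * 0
    rw [mul_zero, add_zero, substPath_mul_idem hf]
  | cons q α ih =>
    change substPath I f (p.comp q) * _ + cls I (p.comp q) * _ =
      substPath I f p * cls I (q.comp α.toPath) + cls I p * (_ + _)
    rw [ih, cls_comp, cls_comp]
    simp only [arrowCls]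
    noncomm_ring

theorem subst_mul (hf : f ∈ homArrows I) (x y : PathAlgebra k V) :
    subst I f (x * y) =
      subst I f x * Ideal.Quotient.mk I y + Ideal.Quotient.mk I x * subst I f y := by
  induction x using path_induction with
  | h0 => simp
  | hadd x x' h h' =>
    simp only [add_mul, map_add, h, h']
    abel
  | hpath c a b p =>
  induction y using path_induction with
  | h0 => simp
  | hadd y y' h h' =>
    simp only [mul_add, map_add, h, h']
    abel
  | hpath c' a' b' q =>
  simp only [map_smul, mk_smul, smul_mul_assoc, mul_smul_comm, ← smul_add]
  rw [subst_ofPath, subst_ofPath]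
  congr 2
  by_cases h : b = a'
  · subst h
    rw [ofPath_mul_ofPath, subst_ofPath, substPath_comp hf]
    rfl
  · rw [ofPath_mul_ofPath_of_ne _ _ h, map_zero, ← substPath_mul_idem hf p,
      ← idem_mul_substPath f q, mul_assoc]
    have h₁ : idem I b * Ideal.Quotient.mk I (ofPath k q) = 0 := cls_mul_cls_of_ne I _ _ h
    have h₂ : Ideal.Quotient.mk I (ofPath k p) * idem I a' = 0 := cls_mul_cls_of_ne I _ _ h
    rw [h₁, ← mul_assoc, h₂]
    simp

end Subst

/-- Strong induction on the length: a path in `I` that is not minimal contains a strictly shorter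
one in `I`. -/
theorem exists_monomialRelation (I : Ideal (PathAlgebra k V)) {a b : V} (p : Path a b)
    (hp : ofPath k p ∈ I) :
    ∃ (c d : V) (x : Path a c) (σ : Path c d) (y : Path d b),
      IsMonomialRelation I σ ∧ p = (x.comp σ).comp y := by
  induction hn : p.length using Nat.strong_induction_on generalizing a b with
  | _ n ih =>
  by_cases hm : IsMonomialRelation I p
  · exact ⟨a, b, Path.nil, p, Path.nil, hm, by simp⟩
  · simp only [IsMonomialRelation, hp, true_and, not_forall] at hm
    obtain ⟨c, d, x, τ, y, hpe, hτ, hl⟩ := hm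
    have hlen := congrArg Path.length hpe
    simp only [Path.length_comp] at hlen
    obtain ⟨c', d', x', σ, y', hσ, rfl⟩ := ih τ.length (by omega) τ hτ rfl
    exact ⟨c', d', x.comp x', σ, y'.comp y, hσ, by simp [hpe, Path.comp_assoc]⟩

theorem hasMonomial_iff {o t : V} {N : ℕ} (br : Fin N ≃ Path o t) (i : Fin N) :
    HasMonomial I br i ↔ ofPath k (br i) ∈ I := by
  constructor
  · rintro ⟨a, b, x, σ, y, hσ, h⟩
    rw [h, ← cls_eq_zero_iff, cls_comp, cls_comp, (cls_eq_zero_iff I σ).2 hσ.1]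
    simp
  · exact exists_monomialRelation I _

section Relations

variable {o t : V} {N : ℕ} {br : Fin N ≃ Path o t}

theorem subst_eq_zero_of_mem_kerD1 {f : Arrow V → PathAlgebra k V ⧸ I} (hf : f ∈ kerD1 I br)
    {r : PathAlgebra k V} (hr : r ∈ relations I br) : subst I f r = 0 :=
  congrFun (LinearMap.mem_ker.1 hf.2) ⟨r, hr⟩

theorem substPath_eq_zero_of_mem {f : Arrow V → PathAlgebra k V ⧸ I} (hf : f ∈ kerD1 I br)
    {a b : V} (p : Path a b) (hp : ofPath k p ∈ I) : substPath I f p = 0 := by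
  obtain ⟨c, d, x, σ, y, hσ, rfl⟩ := exists_monomialRelation I p hp
  have h := subst_eq_zero_of_mem_kerD1 hf (Or.inl ⟨c, d, σ, hσ, rfl⟩)
  rw [subst_ofPath] at h
  rw [substPath_comp hf.1, substPath_comp hf.1, cls_comp, h, (cls_eq_zero_iff I σ).2 hσ.1]
  simp

theorem subst_branchComb_eq_zero {f : Arrow V → PathAlgebra k V ⧸ I} (hf : f ∈ kerD1 I br)
    {c : Fin N → k} (hc : c ∈ relSpace I br) : subst I f (branchComb br c) = 0 := by
  rw [← span_echelonRows (W := relSpace I br)] at hc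
  induction hc using Submodule.span_induction with
  | zero => simp
  | add x y _ _ hx hy => rw [map_add, map_add, hx, hy, add_zero]
  | smul r x _ hx => rw [map_smul, map_smul, hx, smul_zero]
  | mem c hc =>
    -- A row with a single nonzero entry is not in `relations`; it is a branch in `I`, killed
    -- because of a monomial relation that it contains.
    by_cases h : ∃ i j, i ≠ j ∧ c i ≠ 0 ∧ c j ≠ 0
    · exact subst_eq_zero_of_mem_kerD1 hf (Or.inr ⟨c, ⟨hc, h⟩, rfl⟩)
    · obtain ⟨hcW, i, hi, -, -⟩ := hc
      have hci : branchComb br c = ofPath k (br i) := by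
        rw [branchComb_apply, Finset.sum_eq_single i, hi, one_smul]
        · intro j _ hj
          by_contra hne
          refine h ⟨j, i, hj, fun h0 => hne (by rw [h0, zero_smul]), ?_⟩
          rw [hi]
          exact one_ne_zero
        · simp
      have := branchComb_mem br hcW
      rw [hci] at this
      rw [hci, subst_ofPath]
      exact substPath_eq_zero_of_mem hf _ this

/-- The relations generate `I`: a family killed by `D_1` induces a map on `A`. -/
theorem subst_eq_zero_of_mem (hQ : IsToupie o t) {f : Arrow V → PathAlgebra k V ⧸ I}
    (hf : f ∈ kerD1 I br) {x : PathAlgebra k V} (hx : x ∈ I) : subst I f x = 0 := by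
  rw [eq_sum_corner x, map_sum]
  refine Finset.sum_eq_zero fun a _ => ?_
  rw [map_sum]
  refine Finset.sum_eq_zero fun b _ => ?_
  have hmem := corner_mem_span a b x
  have hI := I.mul_mem_right (ofPath k (Path.nil : Path b b))
    (I.mul_mem_left (ofPath k (Path.nil : Path a a)) hx)
  generalize ofPath k (Path.nil : Path a a) * x * ofPath k (Path.nil : Path b b) = y at hmem hI
  -- From source to sink the corner of `x` is a combination of branches. In any other corner there
  -- is at most one path, so a nonzero multiple of it in `I` forces the path into `I`.
  by_cases hab : a = o ∧ b = t
  · obtain ⟨rfl, rfl⟩ := hab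
    rw [← br.surjective.range_comp, ← Fintype.range_linearCombination] at hmem
    obtain ⟨c, rfl⟩ := hmem
    exact subst_branchComb_eq_zero hf hI
  · by_cases hne : Nonempty (Path a b)
    · obtain ⟨p⟩ := hne
      have hr : (Set.range fun p : Path a b => ofPath k p) = {ofPath k p} := by
        ext z
        constructor
        · rintro ⟨q, rfl⟩
          rw [hQ.path_unique (fun h h' => hab ⟨h, h'⟩) q p]
          rfl
        · rintro rfl
          exact ⟨p, rfl⟩
      rw [hr, Submodule.mem_span_singleton] at hmem
      obtain ⟨c, rfl⟩ := hmem
      by_cases hc : c = 0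
      · simp [hc]
      · have hp : ofPath k p ∈ I := by
          have := (I.restrictScalars k).smul_mem c⁻¹ hI
          rwa [smul_smul, inv_mul_cancel₀ hc, one_smul] at this
        rw [map_smul, subst_ofPath, substPath_eq_zero_of_mem hf p hp, smul_zero]
    · rw [not_nonempty_iff] at hne
      rw [Set.range_eq_empty, Submodule.span_empty, Submodule.mem_bot] at hmem
      rw [hmem, map_zero]

end Relations

end Quotient
end Derivations

/-! ## Comparison with Hochschild cohomology -/

section Cocycles

variable {k : Type*} {A : Type*} [Field k] [Ring A] [Algebra k A]

theorem hochschildD0_apply (a x : A) : hochschildD0 k A a x = x * a - a * x := rfl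

theorem mem_cocycles1_iff {d : A →ₗ[k] A} :
    d ∈ cocycles1 k A ↔ ∀ x y, d (x * y) = d x * y + x * d y := by
  constructor
  · intro h x y
    have := congrArg (fun g : A →ₗ[k] A →ₗ[k] A => g x y) (LinearMap.mem_ker.1 h)
    simp only [hochschildD1_apply, LinearMap.zero_apply] at this
    rw [← sub_eq_zero, ← neg_eq_zero, ← this]
    abel
  · intro h
    refine LinearMap.mem_ker.2 (LinearMap.ext₂ fun x y => ?_)
    rw [hochschildD1_apply, h, LinearMap.zero_apply, LinearMap.zero_apply]
    abel

end Cocycles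

section Comparison

open Quiver (Path)

variable {k : Type w} {V : Type u} [Field k] [Quiver.{v} V] [Fintype V]
  {I : Ideal (PathAlgebra k V)} [I.IsTwoSided] {o t : V} {N : ℕ} {br : Fin N ≃ Path o t}

theorem D0_apply (c : V → PathAlgebra k V ⧸ I) (α : Arrow V) :
    D0 I c α = arrowCls I α * c α.2.1 - c α.1 * arrowCls I α := rfl

theorem cls_mul_of_mem_homE {c : V → PathAlgebra k V ⧸ I} (hc : c ∈ homE I) {a b : V}
    (p : Path a b) : cls I p * ∑ x, c x = cls I p * c b := by
  rw [Finset.mul_sum, Finset.sum_eq_single b]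
  · intro x _ hx
    rw [← hc x, ← mul_assoc, ← mul_assoc, idem, cls_mul_cls_of_ne I _ _ hx.symm]
    simp
  · simp

theorem mul_cls_of_mem_homE {c : V → PathAlgebra k V ⧸ I} (hc : c ∈ homE I) {a b : V}
    (p : Path a b) : (∑ x, c x) * cls I p = c a * cls I p := by
  rw [Finset.sum_mul, Finset.sum_eq_single a]
  · intro x _ hx
    rw [← hc x, mul_assoc, idem, cls_mul_cls_of_ne I _ _ hx, mul_zero]
  · simp

theorem D0_mem_homArrows {c : V → PathAlgebra k V ⧸ I} (hc : c ∈ homE I) :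
    D0 I c ∈ homArrows I := by
  intro α
  have h₁ : idem I α.1 * c α.1 = c α.1 := by
    rw [← hc α.1, ← mul_assoc, ← mul_assoc, idem_mul_idem]
  have h₂ : c α.2.1 * idem I α.2.1 = c α.2.1 := by
    rw [← hc α.2.1, mul_assoc, idem_mul_idem]
  have h₃ : idem I α.1 * arrowCls I α = arrowCls I α := idem_mul_cls I _
  have h₄ : arrowCls I α * idem I α.2.1 = arrowCls I α := cls_mul_idem I _
  rw [D0_apply, mul_sub, sub_mul, ← mul_assoc, h₃, mul_assoc, h₂, ← mul_assoc, h₁, mul_assoc, h₄]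

/-- Only `c b` survives in `cls I p * ∑ c` and only `c a` in `(∑ c) * cls I p`, and the
contributions of consecutive arrows telescope. So `D0 I c` extends to an inner derivation. -/
theorem subst_D0 {c : V → PathAlgebra k V ⧸ I} (hc : c ∈ homE I) (x : PathAlgebra k V) :
    subst I (D0 I c) x =
      Ideal.Quotient.mk I x * (∑ y, c y) - (∑ y, c y) * Ideal.Quotient.mk I x := by
  induction x using path_induction with
  | h0 => simp
  | hadd x y hx hy =>
    rw [map_add, hx, hy, map_add, add_mul, mul_add]
    abel
  | hpath r a b p =>
  rw [map_smul, mk_smul, smul_mul_assoc, mul_smul_comm, ← smul_sub, subst_ofPath]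
  congr 1
  change _ = cls I p * _ - _ * cls I p
  rw [cls_mul_of_mem_homE hc, mul_cls_of_mem_homE hc]
  induction p with
  | nil =>
    change 0 = idem I a * c a - c a * idem I a
    rw [← hc a, mul_assoc, mul_assoc, mul_assoc, idem_mul_idem, ← mul_assoc, idem_mul_idem,
      sub_self]
  | @cons b d p α ih =>
    change substPath I (D0 I c) p * _ + cls I p * _ = cls I (p.comp α.toPath) * _ - _ * cls I (p.comp α.toPath)
    rw [ih, cls_comp, D0_apply, arrowCls]
    noncomm_ring

theorem imD0_le_kerD1 : imD0 I ≤ kerD1 I br := by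
  rintro _ ⟨c, hc, rfl⟩
  refine ⟨D0_mem_homArrows hc, LinearMap.mem_ker.2 (funext fun r => ?_)⟩
  change subst I (D0 I c) r.1 = 0
  rw [subst_D0 hc, Ideal.Quotient.eq_zero_iff_mem.2 (relations_subset br r.2)]
  simp

/-- Two derivations that agree on the vertices and on the arrows are equal. -/
theorem cocycle_apply_mk {d : PathAlgebra k V ⧸ I →ₗ[k] PathAlgebra k V ⧸ I}
    (hd : d ∈ cocycles1 k _) (h0 : ∀ x, d (idem I x) = 0) (x : PathAlgebra k V) :
    d (Ideal.Quotient.mk I x) = subst I (fun α => d (arrowCls I α)) x := by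
  rw [mem_cocycles1_iff] at hd
  induction x using path_induction with
  | h0 => simp
  | hadd x y hx hy => rw [map_add, map_add, map_add, hx, hy]
  | hpath r a b p =>
  rw [mk_smul, map_smul, map_smul, subst_ofPath]
  congr 1
  change d (cls I p) = _
  induction p with
  | nil => exact h0 a
  | @cons b c p α ih =>
    change d (cls I (p.comp α.toPath)) = substPath I _ p * _ + _
    rw [cls_comp, hd, ih]
    rfl

section Extension

variable (hQ : IsToupie o t) (f : kerD1 I br)

/-- The derivation of `A` that vanishes on the vertices and is given by an element of `Ker D_1`
on the arrows. -/
def derivationOf : PathAlgebra k V ⧸ I →ₗ[k] PathAlgebra k V ⧸ I :=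
  ((I.restrictScalars k).liftQ (subst I f.1) fun _ hx => subst_eq_zero_of_mem hQ f.2 hx) ∘ₗ
    (Submodule.Quotient.restrictScalarsEquiv k I).symm.toLinearMap

theorem derivationOf_mk (x : PathAlgebra k V) :
    derivationOf hQ f (Ideal.Quotient.mk I x) = subst I f.1 x := rfl

theorem derivationOf_mem : derivationOf hQ f ∈ cocycles1 k (PathAlgebra k V ⧸ I) := by
  refine mem_cocycles1_iff.2 fun x y => ?_
  obtain ⟨x, rfl⟩ := Ideal.Quotient.mk_surjective x
  obtain ⟨y, rfl⟩ := Ideal.Quotient.mk_surjective y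
  rw [← map_mul, derivationOf_mk, derivationOf_mk, derivationOf_mk, subst_mul f.2.1]

theorem derivationOf_idem (x : V) : derivationOf hQ f (idem I x) = 0 :=
  subst_ofPath I f.1 Path.nil

theorem derivationOf_arrow (α : Arrow V) : derivationOf hQ f (arrowCls I α) = f.1 α := by
  refine (subst_ofPath I f.1 α.2.2.toPath).trans ?_
  change (0 : PathAlgebra k V ⧸ I) * _ + idem I α.1 * f.1 α = f.1 α
  rw [zero_mul, zero_add, idem_mul_of_mem_homArrows f.2.1]

end Extension

/-- The map from `Ker D_1` to the Hochschild cocycles. -/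
def toCocycles (hQ : IsToupie o t) : kerD1 I br →ₗ[k] cocycles1 k (PathAlgebra k V ⧸ I) where
  toFun f := ⟨derivationOf hQ f, derivationOf_mem hQ f⟩
  map_add' f g := by
    refine Subtype.ext (LinearMap.ext fun x => ?_)
    obtain ⟨x, rfl⟩ := Ideal.Quotient.mk_surjective x
    exact subst_add I f.1 g.1 x
  map_smul' c f := by
    refine Subtype.ext (LinearMap.ext fun x => ?_)
    obtain ⟨x, rfl⟩ := Ideal.Quotient.mk_surjective x
    exact subst_smul I c f.1 x

/-- The map from `Ker D_1` to `HH^1(A)`. -/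
def toHH1 (hQ : IsToupie o t) : kerD1 I br →ₗ[k] HH1 k (PathAlgebra k V ⧸ I) :=
  ((coboundaries1 k (PathAlgebra k V ⧸ I)).submoduleOf (cocycles1 k _)).mkQ ∘ₗ toCocycles hQ

theorem ker_toHH1 (hQ : IsToupie o t) :
    LinearMap.ker (toHH1 (I := I) (br := br) hQ) = (imD0 I).submoduleOf (kerD1 I br) := by
  ext f
  rw [LinearMap.mem_ker, toHH1, LinearMap.comp_apply, Submodule.mkQ_apply,
    Submodule.Quotient.mk_eq_zero]
  change derivationOf hQ f ∈ coboundaries1 k _ ↔ f.1 ∈ imD0 I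
  constructor
  · rintro ⟨a, ha⟩
    have happ : ∀ x, derivationOf hQ f x = x * a - a * x := fun x => by rw [← ha]; rfl
    have hcomm : ∀ x, idem I x * a = a * idem I x := fun x => by
      rw [← sub_eq_zero, ← happ, derivationOf_idem]
    -- Since the derivation vanishes on the vertices, `a` commutes with every idempotent, so its
    -- diagonal corners induce the same inner derivation.
    refine ⟨fun x => idem I x * a * idem I x, fun x => ?_, funext fun α => ?_⟩
    · change idem I x * (idem I x * a * idem I x) * idem I x = idem I x * a * idem I x
      rw [← mul_assoc, ← mul_assoc, idem_mul_idem, mul_assoc, idem_mul_idem]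
    · rw [D0_apply, ← derivationOf_arrow hQ f α, happ]
      simp only [arrowCls]
      rw [hcomm, mul_assoc a, idem_mul_idem, ← hcomm, ← mul_assoc, cls_mul_idem, hcomm,
        mul_assoc a, idem_mul_idem, mul_assoc, idem_mul_cls]
  · rintro ⟨c, hc, hcf⟩
    refine ⟨∑ x, c x, LinearMap.ext fun x => ?_⟩
    obtain ⟨x, rfl⟩ := Ideal.Quotient.mk_surjective x
    rw [hochschildD0_apply, derivationOf_mk, ← hcf, subst_D0 hc]

/-- Every derivation agrees on the vertices with an inner one. -/
theorem exists_inner_eq_on_idem {d : PathAlgebra k V ⧸ I →ₗ[k] PathAlgebra k V ⧸ I}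
    (hd : d ∈ cocycles1 k _) :
    ∃ a, ∀ y, d (idem I y) = idem I y * a - a * idem I y := by
  rw [mem_cocycles1_iff] at hd
  -- Differentiating $e_ye_y=e_y$ gives $e_yd(e_y)e_y=0$, and $e_xe_y=0$ gives
  -- $e_xd(e_x)e_y=-e_xd(e_y)$. Summing over $x$, with $\sum e_x=1$, yields $ae_y=e_yd(e_y)-d(e_y)$,
  -- while $e_ya=e_yd(e_y)$.
  refine ⟨∑ x, idem I x * d (idem I x), fun y => ?_⟩
  have h1 : d (idem I y) = d (idem I y) * idem I y + idem I y * d (idem I y) := by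
    conv_lhs => rw [← idem_mul_idem, hd]
  have h2 : idem I y * d (idem I y) * idem I y = 0 := by
    have := congrArg (fun z => idem I y * z * idem I y) h1
    simp only [mul_add, add_mul] at this
    rw [← mul_assoc (idem I y) (d _), mul_assoc _ (idem I y) (idem I y), ← mul_assoc (idem I y) (idem I y),
      idem_mul_idem] at this
    exact left_eq_add.1 this
  have h3 : ∀ x, x ≠ y → idem I x * d (idem I x) * idem I y = - (idem I x * d (idem I y)) := by
    intro x hx
    have := hd (idem I x) (idem I y)
    rw [idem_mul_idem_of_ne I hx, map_zero] at this
    have := congrArg (fun z => idem I x * z) this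
    simp only [mul_zero, mul_add, ← mul_assoc, idem_mul_idem] at this
    exact eq_neg_of_add_eq_zero_left this.symm
  have h4 : idem I y * ∑ x, idem I x * d (idem I x) = idem I y * d (idem I y) := by
    rw [Finset.mul_sum, Finset.sum_eq_single y, ← mul_assoc, idem_mul_idem]
    · intro x _ hx
      rw [← mul_assoc, idem_mul_idem_of_ne I hx.symm, zero_mul]
    · simp
  classical
  have h5 : (∑ x, idem I x * d (idem I x)) * idem I y =
      idem I y * d (idem I y) - d (idem I y) := by
    have h6 : ∀ x, idem I x * d (idem I x) * idem I y =
        (if x = y then idem I y * d (idem I y) else 0) - idem I x * d (idem I y) := by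
      intro x
      split_ifs with h
      · rw [h, h2, sub_self]
      · rw [h3 x h, zero_sub]
    rw [Finset.sum_mul]
    simp_rw [h6]
    rw [Finset.sum_sub_distrib, ← Finset.sum_mul, sum_idem, one_mul, Finset.sum_ite_eq']
    simp
  rw [h4, h5]
  abel

/-- Subtract an inner derivation with the same values on the vertices. The remaining derivation
respects corners and is the Leibniz extension of its values on arrows, which therefore kill the
relations. -/
theorem toHH1_surjective (hQ : IsToupie o t) :
    Function.Surjective (toHH1 (I := I) (br := br) hQ) := by
  intro z
  obtain ⟨⟨d, hd⟩, rfl⟩ := Submodule.Quotient.mk_surjective _ z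
  obtain ⟨a, ha⟩ := exists_inner_eq_on_idem hd
  have hin : hochschildD0 k (PathAlgebra k V ⧸ I) a ∈ cocycles1 k (PathAlgebra k V ⧸ I) :=
    hochschildD0_range_le k _ ⟨a, rfl⟩
  have he : d - hochschildD0 k _ a ∈ cocycles1 k (PathAlgebra k V ⧸ I) :=
    Submodule.sub_mem _ hd hin
  have h0 : ∀ x, (d - hochschildD0 k _ a) (idem I x) = 0 := fun x => by
    rw [LinearMap.sub_apply, ha, hochschildD0_apply, sub_self]
  have hder := mem_cocycles1_iff.1 he
  generalize hgen : d - hochschildD0 k _ a = e at he h0 hder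
  have hf : (fun α => e (arrowCls I α)) ∈ kerD1 I br := by
    refine ⟨fun α => ?_, LinearMap.mem_ker.2 (funext fun r => ?_)⟩
    · have h1 : e (idem I α.1 * arrowCls I α * idem I α.2.1) = e (arrowCls I α) := by
        rw [arrowCls, idem_mul_cls, cls_mul_idem]
      change idem I α.1 * e (arrowCls I α) * idem I α.2.1 = e (arrowCls I α)
      rw [← h1, hder, hder, h0, h0]
      simp only [zero_mul, mul_zero, zero_add, add_zero]
      rw [arrowCls, mul_assoc, mul_assoc, mul_assoc, idem_mul_idem, ← mul_assoc, idem_mul_idem,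
        ← mul_assoc]
    · change subst I (fun α => e (arrowCls I α)) r.1 = 0
      rw [← cocycle_apply_mk he h0, Ideal.Quotient.eq_zero_iff_mem.2 (relations_subset br r.2),
        map_zero]
  refine ⟨⟨_, hf⟩, (Submodule.Quotient.eq _).2 ?_⟩
  refine ⟨-a, ?_⟩
  rw [map_neg]
  have : derivationOf hQ ⟨_, hf⟩ = e := by
    refine LinearMap.ext fun x => ?_
    obtain ⟨x, rfl⟩ := Ideal.Quotient.mk_surjective x
    rw [derivationOf_mk, cocycle_apply_mk he h0]
  change _ = derivationOf hQ ⟨_, hf⟩ - d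
  rw [this, ← hgen]
  abel

/-- The isomorphism from `Ker D_1 / Im D_0` to `HH^1(A)`. -/
def comparison (hQ : IsToupie o t) : H1 I br ≃ₗ[k] HH1 k (PathAlgebra k V ⧸ I) :=
  LinearEquiv.ofBijective
    (((imD0 I).submoduleOf (kerD1 I br)).liftQ (toHH1 hQ) (ker_toHH1 hQ).ge)
    ⟨by
      rw [← LinearMap.ker_eq_bot]
      exact Submodule.ker_liftQ_eq_bot _ _ _ (ker_toHH1 hQ).le,
    fun z => by
      obtain ⟨f, hf⟩ := toHH1_surjective (br := br) hQ z
      exact ⟨Submodule.Quotient.mk f, hf⟩⟩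

theorem comparison_mk (hQ : IsToupie o t) (f : kerD1 I br) :
    comparison hQ (Submodule.Quotient.mk f) = Submodule.Quotient.mk (toCocycles hQ f) := rfl

end Comparison

/-! ## The image of `D_0` and the kernel of `D_1` -/

section Families

open Quiver (Path)

variable {k : Type w} {V : Type u} [Field k] [Quiver.{v} V] {o t : V}

/-! ### Coefficients of elements of an admissible ideal -/

section Coefficients

/-- The coefficient of a path in an element of the path algebra. -/
def coeff (p : AnyPath V) : PathAlgebra k V →ₗ[k] k := Finsupp.lapply p

theorem coeff_self {a b : V} (p : Path a b) : coeff ⟨a, b, p⟩ (ofPath k p) = 1 :=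
  Finsupp.single_eq_same

theorem coeff_of_ne {p : AnyPath V} {c d : V} {q : Path c d} (h : p ≠ ⟨c, d, q⟩) :
    coeff p (ofPath k q) = 0 :=
  Finsupp.single_eq_of_ne h

variable [Fintype V] {I : Ideal (PathAlgebra k V)}

/-- Elements of an admissible ideal have no coefficient at the paths of length at most `1`. -/
theorem coeff_eq_zero_of_mem (hI : IsAdmissible I) {a b : V} (p : Path a b) (hp : p.length < 2)
    {x : PathAlgebra k V} (hx : x ∈ I) : coeff ⟨a, b, p⟩ x = 0 := by
  have h : Submodule.span k {x | ∃ (a b : V) (p : Path a b), 2 ≤ p.length ∧ x = ofPath k p} ≤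
      LinearMap.ker (coeff (k := k) ⟨a, b, p⟩) := by
    refine Submodule.span_le.2 ?_
    rintro _ ⟨c, d, q, hq, rfl⟩
    refine coeff_of_ne fun h => ?_
    cases h
    omega
  exact h (hI.1 hx)

theorem two_le_length_of_mem (hI : IsAdmissible I) {a b : V} {p : Path a b}
    (hp : ofPath k p ∈ I) : 2 ≤ p.length := by
  by_contra h
  have := coeff_eq_zero_of_mem hI p (by omega) hp
  rw [coeff_self] at this
  exact one_ne_zero this

variable {N : ℕ} {br : Fin N ≃ Path o t}

theorem coeff_branchComb (c : Fin N → k) (i : Fin N) :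
    coeff ⟨o, t, br i⟩ (branchComb br c) = c i := by
  rw [branchComb_apply, map_sum, Finset.sum_eq_single i]
  · rw [map_smul, coeff_self, smul_eq_mul, mul_one]
  · intro j _ hj
    rw [map_smul, coeff_of_ne, smul_zero]
    intro h
    simp only [Sigma.mk.injEq, heq_eq_eq, true_and] at h
    exact hj (br.injective h).symm
  · simp

theorem eq_zero_of_isArrowBranch (hI : IsAdmissible I) {c : Fin N → k} (hc : c ∈ relSpace I br)
    {i : Fin N} (hi : IsArrowBranch br i) : c i = 0 := by
  rw [← coeff_branchComb (br := br) c i]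
  exact coeff_eq_zero_of_mem hI _ (by rw [hi]; norm_num) hc

theorem isIrreducibleBranch_of_isArrowBranch (hI : IsAdmissible I) {i : Fin N}
    (hi : IsArrowBranch br i) : IsIrreducibleBranch I br i := by
  rintro ⟨c, hc, hne, -⟩
  exact hne (eq_zero_of_isArrowBranch hI hc hi)

theorem branchComb_single (i : Fin N) :
    branchComb br (Pi.single i (1 : k)) = ofPath k (br i) := by
  rw [branchComb, Fintype.linearCombination_apply_single, one_smul]

/-- A branch in `I` is involved in no non monomial relation. -/
theorem eq_zero_of_branch_mem {c : Fin N → k} (hc : c ∈ nonMonomialRelations I br) {i : Fin N}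
    (hi : ofPath k (br i) ∈ I) : c i = 0 := by
  obtain ⟨⟨hcW, m, h1, -, h3⟩, j, l, hjl, hj, hl⟩ := hc
  have hW : Pi.single i (1 : k) ∈ relSpace I br := by
    change branchComb br _ ∈ I
    rwa [branchComb_single]
  have hp : IsPivot (relSpace I br) i :=
    ⟨_, hW, by simp, fun j hj => Pi.single_eq_of_ne hj.ne _⟩
  -- At its own pivot the row would be the unit vector, which has only one nonzero entry; at every
  -- other pivot a reduced row vanishes.
  by_cases him : i = m
  · subst him
    have h0 : c - Pi.single i (1 : k) = 0 := by
      refine eq_zero_of_forall_pivot (Submodule.sub_mem _ hcW hW) fun p hp => ?_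
      by_cases hpi : p = i
      · subst hpi
        simp [h1]
      · simp [h3 p hpi hp, hpi]
    rw [sub_eq_zero] at h0
    have aux : ∀ q, c q ≠ 0 → q = i := fun q hq => by
      by_contra hqi
      exact hq (by rw [h0, Pi.single_eq_of_ne hqi])
    exact absurd ((aux j hj).trans (aux l hl).symm) hjl
  · exact h3 i him hp

end Coefficients

variable [Fintype V] {I : Ideal (PathAlgebra k V)}

theorem par_apply_self (α : Arrow V) (x : PathAlgebra k V ⧸ I) : par I α x α = x := by
  classical exact Pi.single_eq_same _ _

theorem par_apply_of_ne {α β : Arrow V} (h : β ≠ α) (x : PathAlgebra k V ⧸ I) :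
    par I α x β = 0 := by
  classical exact Pi.single_eq_of_ne h _

variable [I.IsTwoSided]

theorem arrowCls_ne_zero (hI : IsAdmissible I) (α : Arrow V) : arrowCls I α ≠ 0 := by
  intro h
  have := two_le_length_of_mem hI ((cls_eq_zero_iff I _).1 h)
  rw [Quiver.Path.length_toPath] at this
  omega

/-- A family of scalar multiples of the idempotents. -/
def potential (I : Ideal (PathAlgebra k V)) [I.IsTwoSided] (γ : V → k) :
    V → PathAlgebra k V ⧸ I :=
  fun x => γ x • idem I x

theorem potential_mem_homE (γ : V → k) : potential I γ ∈ homE I := by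
  intro x
  simp only [potential, mul_smul_comm, smul_mul_assoc, idem_mul_idem]

theorem D0_potential (γ : V → k) (α : Arrow V) :
    D0 I (potential I γ) α = (γ α.2.1 - γ α.1) • arrowCls I α := by
  rw [D0_apply, potential, potential, mul_smul_comm, smul_mul_assoc, arrowCls, cls_mul_idem,
    idem_mul_cls, sub_smul]

/-- There are no nontrivial closed paths, so an element of `homE` is a scalar at each vertex and
`D0` is the graph coboundary of that function. -/
theorem mem_imD0_iff (hQ : IsToupie o t) {f : Arrow V → PathAlgebra k V ⧸ I} :
    f ∈ imD0 I ↔ ∃ γ : V → k, ∀ α : Arrow V, f α = (γ α.2.1 - γ α.1) • arrowCls I α := by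
  constructor
  · rintro ⟨c, hc, rfl⟩
    have hex : ∀ x, ∃ r : k, c x = r • idem I x := by
      intro x
      have h := corner_cls_mem_span I x x (c x)
      have hr : (Set.range fun p : Path x x => cls I p) = {idem I x} := by
        ext z
        constructor
        · rintro ⟨p, rfl⟩
          rw [hQ.closed_path_eq_nil p]
          rfl
        · rintro rfl
          exact ⟨Path.nil, rfl⟩
      rw [hc x, hr, Submodule.mem_span_singleton] at h
      obtain ⟨r, hr⟩ := h
      exact ⟨r, hr.symm⟩
    choose γ hγ using hex
    obtain rfl : c = potential I γ := funext hγ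
    exact ⟨γ, D0_potential γ⟩
  · rintro ⟨γ, h⟩
    exact ⟨potential I γ, potential_mem_homE γ, funext fun α => by rw [h, D0_potential]⟩

theorem par_mem_homArrows {α : Arrow V} {x : PathAlgebra k V ⧸ I}
    (hx : idem I α.1 * x * idem I α.2.1 = x) : par I α x ∈ homArrows I := by
  intro β
  by_cases h : β = α
  · subst h
    rw [par_apply_self, hx]
  · rw [par_apply_of_ne h]
    simp

/-- Two consecutive arrows are equivalent modulo `Im D_0`. -/
theorem par_sub_par_mem (hQ : IsToupie o t) {x y z : V} (α : x ⟶ y) (β : y ⟶ z) :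
    par I ⟨y, z, β⟩ (arrowCls I ⟨y, z, β⟩) - par I ⟨x, y, α⟩ (arrowCls I ⟨x, y, α⟩) ∈
      imD0 I := by
  classical
  -- Only `α` enters the middle vertex `y` and only `β` leaves it, so this potential has coboundary
  -- `-1` on `α`, `1` on `β` and `0` elsewhere.
  refine (mem_imD0_iff hQ).2 ⟨fun v => if v = y then -1 else 0, ?_⟩
  rintro ⟨a, b, δ⟩
  have hα : par I ⟨x, y, α⟩ (arrowCls I ⟨x, y, α⟩) ⟨a, b, δ⟩ =
      (if b = y then (1 : k) else 0) • arrowCls I ⟨a, b, δ⟩ := by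
    split_ifs with h
    · subst h
      cases hQ.in_unique (hQ.ne_sink_of_arrow β) α δ
      rw [par_apply_self, one_smul]
    · rw [par_apply_of_ne, zero_smul]
      intro h'
      cases h'
      exact h rfl
  have hβ : par I ⟨y, z, β⟩ (arrowCls I ⟨y, z, β⟩) ⟨a, b, δ⟩ =
      (if a = y then (1 : k) else 0) • arrowCls I ⟨a, b, δ⟩ := by
    split_ifs with h
    · subst h
      cases hQ.out_unique (hQ.ne_source_of_arrow α) β δ
      rw [par_apply_self, one_smul]
    · rw [par_apply_of_ne, zero_smul]
      intro h'
      cases h'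
      exact h rfl
  rw [Pi.sub_apply, hα, hβ, ← sub_smul]
  congr 1
  change _ = (if b = y then (-1 : k) else 0) - if a = y then (-1 : k) else 0
  split_ifs <;> simp

theorem par_sub_par_mem_of_mem_arrows (hQ : IsToupie o t) {x y b : V} (α : x ⟶ y) (p : Path y b)
    {β : Arrow V} (hβ : β ∈ arrows p) :
    par I β (arrowCls I β) - par I ⟨x, y, α⟩ (arrowCls I ⟨x, y, α⟩) ∈ imD0 I := by
  induction p generalizing β with
  | nil => simp [arrows] at hβ
  | @cons b c p δ ih =>
    rw [arrows, List.mem_append, List.mem_singleton] at hβ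
    rcases hβ with hβ | rfl
    · exact ih hβ
    · cases p with
      | nil => exact par_sub_par_mem hQ α δ
      | @cons b' _ p ε =>
        have h₁ := ih (β := ⟨b', b, ε⟩) (by simp [arrows])
        have h₂ := par_sub_par_mem (I := I) hQ ε δ
        have := Submodule.add_mem _ h₂ h₁
        rwa [sub_add_sub_cancel] at this

/-! ### Families attached to branches -/

section Branches

variable {N : ℕ} {br : Fin N ≃ Path o t}

theorem diag_zero (hQ : IsToupie o t) (i : Fin N) :
    diag I br i 0 = par I (firstArrow br hQ i) (arrowCls I (firstArrow br hQ i)) := by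
  rw [diag, arrows_branch br hQ i]
  rfl

theorem branchPar_eq (hQ : IsToupie o t) (p q : Fin N) :
    branchPar I br p q = par I (firstArrow br hQ p) (cls I (br q)) := by
  rw [branchPar, arrows_branch br hQ p]
  rfl

theorem cls_branch (hQ : IsToupie o t) (i : Fin N) :
    cls I (br i) = arrowCls I (firstArrow br hQ i) * cls I (branchTail br hQ i) := by
  rw [branch_eq br hQ i, cls_comp]
  rfl

theorem cls_branch_of_isArrowBranch (hQ : IsToupie o t) {i : Fin N} (hi : IsArrowBranch br i) :
    cls I (br i) = arrowCls I (firstArrow br hQ i) := by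
  obtain ⟨α, hα⟩ := exists_toPath_of_isArrowBranch br hi
  rw [firstArrow_eq br hQ i α Path.nil (by rw [hα, Path.comp_nil]), hα]
  rfl

theorem diag_sub_diag_mem (hQ : IsToupie o t) (i : Fin N) {j : ℕ} (h0 : 0 < j)
    (hj : j < (br i).length) : diag I br i j - diag I br i 0 ∈ imD0 I := by
  obtain ⟨j, rfl⟩ := Nat.exists_eq_succ_of_ne_zero h0.ne'
  rw [length_branch br hQ i, ← length_arrows] at hj
  have hl : j < (arrows (branchTail br hQ i)).length := by omega
  have : diag I br i (j + 1) = par I (arrows (branchTail br hQ i))[j]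
      (arrowCls I (arrows (branchTail br hQ i))[j]) := by
    rw [diag, arrows_branch br hQ i, List.getElem?_cons_succ, List.getElem?_eq_getElem hl]
    rfl
  rw [Nat.succ_eq_add_one, this, diag_zero hQ]
  exact par_sub_par_mem_of_mem_arrows hQ _ _ (List.getElem_mem hl)

theorem diag_zero_apply_self (hQ : IsToupie o t) (i : Fin N) :
    diag I br i 0 (firstArrow br hQ i) = arrowCls I (firstArrow br hQ i) := by
  rw [diag_zero hQ, par_apply_self]

theorem diag_zero_apply_of_ne (hQ : IsToupie o t) {i j : Fin N} (h : j ≠ i) :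
    diag I br i 0 (firstArrow br hQ j) = 0 := by
  rw [diag_zero hQ, par_apply_of_ne fun h' => h (firstArrow_injective br hQ h')]

theorem branchPar_apply_self (hQ : IsToupie o t) (p q : Fin N) :
    branchPar I br p q (firstArrow br hQ p) = cls I (br q) := by
  rw [branchPar_eq hQ, par_apply_self]

theorem branchPar_apply_of_ne (hQ : IsToupie o t) {p q j : Fin N} (h : j ≠ p) :
    branchPar I br p q (firstArrow br hQ j) = 0 := by
  rw [branchPar_eq hQ, par_apply_of_ne fun h' => h (firstArrow_injective br hQ h')]

theorem diag_zero_apply_of_ne_source (hQ : IsToupie o t) (i : Fin N) {α : Arrow V}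
    (h : α.1 ≠ o) : diag I br i 0 α = 0 := by
  rw [diag_zero hQ, par_apply_of_ne]
  rintro rfl
  exact h rfl

theorem branchPar_apply_of_ne_source (hQ : IsToupie o t) (p q : Fin N) {α : Arrow V}
    (h : α.1 ≠ o) : branchPar I br p q α = 0 := by
  rw [branchPar_eq hQ, par_apply_of_ne]
  rintro rfl
  exact h rfl

theorem diag_zero_mem_homArrows (hQ : IsToupie o t) (i : Fin N) :
    diag I br i 0 ∈ homArrows I := by
  rw [diag_zero hQ]
  refine par_mem_homArrows ?_
  rw [arrowCls, idem_mul_cls, cls_mul_idem]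

theorem branchPar_mem_homArrows (hQ : IsToupie o t) {p : Fin N} (hp : IsArrowBranch br p)
    (q : Fin N) : branchPar I br p q ∈ homArrows I := by
  obtain ⟨α, hα⟩ := exists_toPath_of_isArrowBranch br hp
  rw [branchPar_eq hQ, firstArrow_eq br hQ p α Path.nil (by rw [hα, Path.comp_nil])]
  refine par_mem_homArrows ?_
  rw [idem_mul_cls, cls_mul_idem]

theorem sElt_mem_imD0 (hQ : IsToupie o t) : sElt I br ∈ imD0 I := by
  classical
  -- No arrow enters the source, so the coboundary is `1` on the arrows leaving it, which are the
  -- first arrows of the branches, and `0` on all others.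
  refine (mem_imD0_iff hQ).2 ⟨fun v => if v = o then -1 else 0, ?_⟩
  rintro ⟨a, b, α⟩
  rw [sElt, Finset.sum_apply]
  by_cases h : a = o
  · subst h
    obtain ⟨i, hi⟩ := exists_firstArrow_eq br hQ α
    rw [← hi, Finset.sum_eq_single i, diag_zero_apply_self hQ, hi]
    · simp [hQ.ne_source_of_arrow α]
    · intro j _ hj
      exact diag_zero_apply_of_ne hQ hj.symm
    · simp
  · rw [Finset.sum_eq_zero fun i _ => diag_zero_apply_of_ne_source hQ i h]
    simp [hQ.ne_source_of_arrow α, h]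

theorem setK_subset_imD0 (hQ : IsToupie o t) : setK I br ⊆ imD0 I := by
  rintro f ((hf | ⟨i, j, -, h0, hj, rfl⟩) | ⟨i, j, -, -, h0, hj, rfl⟩)
  · rw [hf]
    exact sElt_mem_imD0 hQ
  · exact diag_sub_diag_mem hQ i h0 hj
  · exact diag_sub_diag_mem hQ i h0 hj

/-! ### Families supported on the arrows leaving the source -/

section SupportedAtSource

variable {f : Arrow V → PathAlgebra k V ⧸ I}

theorem substPath_eq_zero_of_ne_source (hQ : IsToupie o t) (h0 : ∀ α, α.1 ≠ o → f α = 0)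
    {a b : V} (ha : a ≠ o) (p : Path a b) : substPath I f p = 0 := by
  induction p with
  | nil => rfl
  | @cons b c p α ih =>
    rw [substPath, ih, h0 ⟨b, c, α⟩ (hQ.ne_source_of_path ha p)]
    simp

theorem substPath_toPath_comp (hQ : IsToupie o t) (hf : f ∈ homArrows I)
    (h0 : ∀ α, α.1 ≠ o → f α = 0) {y b : V} (α : o ⟶ y) (r : Path y b) :
    substPath I f (α.toPath.comp r) = f ⟨o, y, α⟩ * cls I r := by
  rw [substPath_comp hf, substPath_eq_zero_of_ne_source hQ h0 (hQ.ne_source_of_arrow α), mul_zero,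
    add_zero]
  congr 1
  change (0 : PathAlgebra k V ⧸ I) * _ + idem I o * f ⟨o, y, α⟩ = _
  rw [zero_mul, zero_add]
  exact idem_mul_of_mem_homArrows hf ⟨o, y, α⟩

theorem substPath_branch (hQ : IsToupie o t) (hf : f ∈ homArrows I)
    (h0 : ∀ α, α.1 ≠ o → f α = 0) {Λ : k} {i : Fin N}
    (h1 : f (firstArrow br hQ i) = Λ • arrowCls I (firstArrow br hQ i)) :
    substPath I f (br i) = Λ • cls I (br i) := by
  rw [cls_branch hQ, ← smul_mul_assoc, ← h1]
  conv_lhs => rw [branch_eq br hQ i]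
  exact substPath_toPath_comp hQ hf h0 _ _

/-- Only the first arrow of a branch contributes, so `f` rescales the `i`-th coefficient by `Λ i`.
At branches that are arrows `Λ` is meaningless, but there `c` vanishes. -/
theorem subst_branchComb (hQ : IsToupie o t) (hf : f ∈ homArrows I)
    (h0 : ∀ α, α.1 ≠ o → f α = 0) {Λ : Fin N → k}
    (h1 : ∀ i, ¬ IsArrowBranch br i →
      f (firstArrow br hQ i) = Λ i • arrowCls I (firstArrow br hQ i))
    {c : Fin N → k} (hc : ∀ i, IsArrowBranch br i → c i = 0) :
    subst I f (branchComb br c) = Ideal.Quotient.mk I (branchComb br fun i => c i * Λ i) := by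
  rw [branchComb_apply, branchComb_apply, map_sum, map_sum]
  refine Finset.sum_congr rfl fun i _ => ?_
  rw [map_smul, mk_smul, subst_ofPath]
  by_cases hi : IsArrowBranch br i
  · simp [hc i hi]
  · rw [substPath_branch hQ hf h0 (h1 i hi), smul_smul]
    rfl

/-- A family supported on the arrows that start at the source and diagonal at the branches that
are not arrows lies in `Ker D_1` if and only if its coefficients at two branches involved in the
same non monomial relation agree. -/
theorem mem_kerD1_iff (hQ : IsToupie o t) (hI : IsAdmissible I) (hf : f ∈ homArrows I)
    (h0 : ∀ α, α.1 ≠ o → f α = 0) {Λ : Fin N → k}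
    (h1 : ∀ i, ¬ IsArrowBranch br i →
      f (firstArrow br hQ i) = Λ i • arrowCls I (firstArrow br hQ i)) :
    f ∈ kerD1 I br ↔ ∀ c ∈ nonMonomialRelations I br, ∀ i j, c i ≠ 0 → c j ≠ 0 → Λ i = Λ j := by
  constructor
  · intro h c hc i j hi hj
    have h2 := subst_branchComb_eq_zero h hc.1.1
    rw [subst_branchComb hQ hf h0 h1 fun i hi => eq_zero_of_isArrowBranch hI hc.1.1 hi] at h2
    exact eq_of_mul_mem_of_mem_echelonRows hc.1 (Ideal.Quotient.eq_zero_iff_mem.1 h2) hi hj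
  · intro h
    refine ⟨hf, LinearMap.mem_ker.2 (funext ?_)⟩
    rintro ⟨r, ⟨a, b, σ, hσ, rfl⟩ | ⟨c, hc, rfl⟩⟩
    · change subst I f (ofPath k σ) = 0
      rw [subst_ofPath]
      by_cases ha : a = o
      · subst ha
        have hl := two_le_length_of_mem hI hσ.1
        obtain ⟨y, α, r, hr, rfl⟩ := Path.eq_toPath_comp_of_length_eq_succ σ
          (n := σ.length - 1) (by omega)
        obtain ⟨i, hi⟩ := exists_firstArrow_eq br hQ α
        -- A monomial relation has length at least `2`; if its first arrow ended at the sink,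
        -- nothing could follow. So `f` is diagonal at that arrow.
        have hna : ¬ IsArrowBranch br i := by
          rw [isArrowBranch_iff br hQ]
          intro hy
          have hy' : y = t := by
            rw [← hy]
            exact (congrArg (fun β : Arrow V => β.2.1) hi).symm
          subst hy'
          obtain rfl := hQ.eq_sink_of_path r
          rw [hQ.path_sink_sink r] at hr hl
          simp at hr hl
        have := h1 i hna
        rw [hi] at this
        rw [substPath_toPath_comp hQ hf h0, this, smul_mul_assoc, arrowCls, ← cls_comp,
          (cls_eq_zero_iff I _).2 hσ.1, smul_zero]
      · exact substPath_eq_zero_of_ne_source hQ h0 ha σ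
    · change subst I f (branchComb br c) = 0
      rw [subst_branchComb hQ hf h0 h1 fun i hi => eq_zero_of_isArrowBranch hI hc.1.1 hi]
      obtain ⟨i, -, -, hi, -⟩ := hc.2
      have hΛ : (fun j => c j * Λ j) = Λ i • c := by
        funext j
        by_cases hj : c j = 0
        · simp [hj]
        · rw [h c hc j i hj hi, Pi.smul_apply, smul_eq_mul, mul_comm]
      rw [hΛ, map_smul, mk_smul, Ideal.Quotient.eq_zero_iff_mem.2 (branchComb_mem br hc.1.1),
        smul_zero]

end SupportedAtSource

end Branches

end Families

/-! ## Generators of `Ker D_1 / Im D_0` and their relations -/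

section Generators

open Quiver (Path)

open scoped Classical

variable {k : Type w} {V : Type u} [Field k] [Quiver.{v} V] [Fintype V] {o t : V}
  {I : Ideal (PathAlgebra k V)} [I.IsTwoSided] {N : ℕ} {br : Fin N ≃ Path o t}

theorem sum_eq_sum_subtype {ι M : Type*} [Fintype ι] [AddCommMonoid M] {P : ι → Prop}
    {F : ι → M} (h : ∀ i, ¬ P i → F i = 0) : ∑ i, F i = ∑ i : {i // P i}, F i.1 := by
  rw [← Fintype.sum_subtype_add_sum_subtype P F,
    Finset.sum_eq_zero (s := (Finset.univ : Finset {i // ¬ P i})) fun i _ => h i.1 i.2, add_zero]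

/-- A linear relation between these classes is a vector of `relSpace` that vanishes at all pivots.
-/
theorem linearIndependent_irreducible :
    LinearIndependent k fun q : {q // IsIrreducibleBranch I br q} => cls I (br q.1) := by
  rw [Fintype.linearIndependent_iff]
  intro g hg q
  have hsum : branchComb br (fun i => if h : IsIrreducibleBranch I br i then g ⟨i, h⟩ else 0) =
      ∑ q : {q // IsIrreducibleBranch I br q}, g q • ofPath k (br q.1) := by
    rw [branchComb_apply, sum_eq_sum_subtype (P := IsIrreducibleBranch I br)]
    · exact Finset.sum_congr rfl fun q _ => by rw [dif_pos q.2]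
    · exact fun i hi => by rw [dif_neg hi, zero_smul]
  have hmem : (fun i => if h : IsIrreducibleBranch I br i then g ⟨i, h⟩ else 0) ∈
      relSpace I br := by
    change branchComb br _ ∈ I
    rw [← Ideal.Quotient.eq_zero_iff_mem, hsum, map_sum]
    exact hg
  have := congrFun (eq_zero_of_forall_pivot hmem fun i hi => dif_neg (not_not.2 hi)) q.1
  simpa [q.2] using this

/-- Subtracting an element of `relSpace` with the same pivot entries leaves a combination of
irreducible branches only. -/
theorem corner_eq_sum_irreducible (x : PathAlgebra k V ⧸ I) :
    ∃ m : {q // IsIrreducibleBranch I br q} → k,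
      idem I o * x * idem I t = ∑ q, m q • cls I (br q.1) := by
  have h := corner_cls_mem_span I o t x
  rw [← br.surjective.range_comp, ← Fintype.range_linearCombination] at h
  obtain ⟨v, hv⟩ := h
  obtain ⟨c, hc, hcv⟩ := exists_mem_forall_pivot_eq (relSpace I br) v
  have h1 : Ideal.Quotient.mk I (branchComb br (v - c)) = idem I o * x * idem I t := by
    rw [map_sub, map_sub, Ideal.Quotient.eq_zero_iff_mem.2 (branchComb_mem br hc), sub_zero, ← hv,
      branchComb_apply, map_sum]
    rfl
  refine ⟨fun q => (v - c) q.1, ?_⟩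
  rw [← h1, branchComb_apply, map_sum, sum_eq_sum_subtype (P := IsIrreducibleBranch I br)]
  · rfl
  · intro i hi
    rw [Pi.sub_apply, hcv i (not_not.1 hi), sub_self, zero_smul, map_zero]

/-- The index set of the generators `y_i`, `t_κ` and `α^(p) ∥ α^(q)` of `Ker D_1 / Im D_0`. -/
abbrev GenIndex (I : Ideal (PathAlgebra k V)) (br : Fin N ≃ Path o t) : Type :=
  {i // HasMonomial I br i} ⊕ (QRho I br).ConnectedComponent ⊕
    ({p // IsArrowBranch br p} × {q // IsIrreducibleBranch I br q})

/-- The generators of `Ker D_1 / Im D_0`. -/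
def gen (I : Ideal (PathAlgebra k V)) [I.IsTwoSided] (br : Fin N ≃ Path o t) :
    GenIndex I br → Arrow V → PathAlgebra k V ⧸ I :=
  Sum.elim (fun i => diag I br i.1 0)
    (Sum.elim (tElt I br) fun pq => branchPar I br pq.1.1 pq.2.1)

/-- The linear combinations of the generators. -/
def genComb (I : Ideal (PathAlgebra k V)) [I.IsTwoSided] (br : Fin N ≃ Path o t)
    (c : GenIndex I br → k) : Arrow V → PathAlgebra k V ⧸ I :=
  ∑ j, c j • gen I br j

theorem genComb_apply (c : GenIndex I br → k) (α : Arrow V) :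
    genComb I br c α = ∑ i, c (Sum.inl i) • diag I br i.1 0 α +
      (∑ κ, c (Sum.inr (Sum.inl κ)) • tElt I br κ α +
        ∑ p, ∑ q, c (Sum.inr (Sum.inr (p, q))) • branchPar I br p.1 q.1 α) := by
  rw [genComb, Finset.sum_apply, Fintype.sum_sum_type, Fintype.sum_sum_type,
    Fintype.sum_prod_type]
  rfl

theorem not_isArrowBranch_of_hasMonomial (hI : IsAdmissible I) {i : Fin N}
    (hi : HasMonomial I br i) : ¬ IsArrowBranch br i := by
  intro h
  have := two_le_length_of_mem hI ((hasMonomial_iff br i).1 hi)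
  rw [IsArrowBranch] at h
  omega

section Values

variable (hQ : IsToupie o t)

include hQ

theorem tElt_apply_of_ne_source (κ : (QRho I br).ConnectedComponent) {α : Arrow V}
    (h : α.1 ≠ o) : tElt I br κ α = 0 := by
  rw [tElt, Finset.sum_apply]
  refine Finset.sum_eq_zero fun i _ => ?_
  split_ifs
  · exact diag_zero_apply_of_ne_source hQ _ h
  · rfl

theorem tElt_apply_vertex (κ : (QRho I br).ConnectedComponent) (i : QRhoVertex I br) :
    tElt I br κ (firstArrow br hQ i.1) =
      if (QRho I br).connectedComponentMk i = κ then arrowCls I (firstArrow br hQ i.1) else 0 := by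
  rw [tElt, Finset.sum_apply, Finset.sum_eq_single i]
  · split_ifs
    · exact diag_zero_apply_self hQ i.1
    · rfl
  · intro j _ hj
    split_ifs
    · exact diag_zero_apply_of_ne hQ fun h => hj (Subtype.ext h.symm)
    · rfl
  · simp

theorem tElt_apply_of_not_vertex (κ : (QRho I br).ConnectedComponent) {i : Fin N}
    (hi : ¬ (¬ IsArrowBranch br i ∧ ¬ HasMonomial I br i)) :
    tElt I br κ (firstArrow br hQ i) = 0 := by
  rw [tElt, Finset.sum_apply]
  refine Finset.sum_eq_zero fun j _ => ?_
  split_ifs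
  · refine diag_zero_apply_of_ne hQ ?_
    rintro rfl
    exact hi j.2
  · rfl

theorem genComb_apply_of_ne_source (c : GenIndex I br → k) {α : Arrow V} (h : α.1 ≠ o) :
    genComb I br c α = 0 := by
  rw [genComb_apply]
  simp [diag_zero_apply_of_ne_source hQ _ h, tElt_apply_of_ne_source hQ _ h,
    branchPar_apply_of_ne_source hQ _ _ h]

theorem genComb_apply_of_hasMonomial (hI : IsAdmissible I) (c : GenIndex I br → k)
    (i : {i // HasMonomial I br i}) :
    genComb I br c (firstArrow br hQ i.1) =
      c (Sum.inl i) • arrowCls I (firstArrow br hQ i.1) := by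
  rw [genComb_apply, Finset.sum_eq_single i, diag_zero_apply_self hQ,
    Finset.sum_eq_zero fun κ _ => by
      rw [tElt_apply_of_not_vertex hQ κ fun h => h.2 i.2, smul_zero],
    Finset.sum_eq_zero fun p _ => Finset.sum_eq_zero fun q _ => by
      rw [branchPar_apply_of_ne hQ, smul_zero]
      intro h
      exact not_isArrowBranch_of_hasMonomial hI i.2 (h ▸ p.2), add_zero, add_zero]
  · intro j _ hj
    rw [diag_zero_apply_of_ne hQ fun h => hj (Subtype.ext h.symm), smul_zero]
  · simp

theorem genComb_apply_vertex (c : GenIndex I br → k) (i : QRhoVertex I br) :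
    genComb I br c (firstArrow br hQ i.1) =
      c (Sum.inr (Sum.inl ((QRho I br).connectedComponentMk i))) •
        arrowCls I (firstArrow br hQ i.1) := by
  rw [genComb_apply, Finset.sum_eq_zero fun j _ => by
      rw [diag_zero_apply_of_ne hQ, smul_zero]
      intro h
      exact i.2.2 (h ▸ j.2),
    Finset.sum_eq_single ((QRho I br).connectedComponentMk i), tElt_apply_vertex, if_pos rfl,
    Finset.sum_eq_zero fun p _ => Finset.sum_eq_zero fun q _ => by
      rw [branchPar_apply_of_ne hQ, smul_zero]
      intro h
      exact i.2.1 (h ▸ p.2), zero_add, add_zero]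
  · intro κ _ hκ
    rw [tElt_apply_vertex, if_neg hκ.symm, smul_zero]
  · simp

theorem genComb_apply_arrow (hI : IsAdmissible I) (c : GenIndex I br → k)
    (p : {p // IsArrowBranch br p}) :
    genComb I br c (firstArrow br hQ p.1) =
      ∑ q, c (Sum.inr (Sum.inr (p, q))) • cls I (br q.1) := by
  rw [genComb_apply, Finset.sum_eq_zero fun j _ => by
      rw [diag_zero_apply_of_ne hQ, smul_zero]
      intro h
      exact not_isArrowBranch_of_hasMonomial hI j.2 (h ▸ p.2),
    Finset.sum_eq_zero fun κ _ => by
      rw [tElt_apply_of_not_vertex hQ κ fun h => h.1 p.2, smul_zero],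
    Finset.sum_eq_single p, zero_add, zero_add]
  · simp_rw [branchPar_apply_self hQ]
  · intro p' _ hp'
    refine Finset.sum_eq_zero fun q _ => ?_
    rw [branchPar_apply_of_ne hQ fun h => hp' (Subtype.ext h.symm), smul_zero]
  · simp

end Values

theorem tElt_mem_homArrows (hQ : IsToupie o t) (κ : (QRho I br).ConnectedComponent) :
    tElt I br κ ∈ homArrows I := by
  rw [tElt]
  refine Submodule.sum_mem _ fun i _ => ?_
  split_ifs
  · exact diag_zero_mem_homArrows hQ _
  · exact Submodule.zero_mem _

/-- The multipliers for `mem_kerD1_iff` are the indicator of the branch, the indicator of the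
component, and `0`. A branch in `I` occurs in no non monomial relation, and distinct branches of one
such relation are adjacent in `QRho`. -/
theorem gen_mem_kerD1 (hQ : IsToupie o t) (hI : IsAdmissible I) (j : GenIndex I br) :
    gen I br j ∈ kerD1 I br := by
  rcases j with i | κ | ⟨p, q⟩
  · change diag I br i.1 0 ∈ kerD1 I br
    rw [mem_kerD1_iff (Λ := Pi.single i.1 1) hQ hI (diag_zero_mem_homArrows hQ _)
      fun α hα => diag_zero_apply_of_ne_source hQ _ hα]
    · intro c hc a b ha hb
      have aux : ∀ a, c a ≠ 0 → a ≠ i.1 := by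
        rintro a ha rfl
        exact ha (eq_zero_of_branch_mem hc ((hasMonomial_iff br _).1 i.2))
      rw [Pi.single_eq_of_ne (aux a ha), Pi.single_eq_of_ne (aux b hb)]
    · intro a _
      by_cases h : a = i.1
      · rw [h, diag_zero_apply_self hQ, Pi.single_eq_same, one_smul]
      · rw [diag_zero_apply_of_ne hQ h, Pi.single_eq_of_ne h, zero_smul]
  · change tElt I br κ ∈ kerD1 I br
    rw [mem_kerD1_iff (Λ := fun i => if ∃ h, (QRho I br).connectedComponentMk ⟨i, h⟩ = κ
      then 1 else 0) hQ hI (tElt_mem_homArrows hQ κ)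
      fun α hα => tElt_apply_of_ne_source hQ κ hα]
    · intro c hc a b ha hb
      have aux : ∀ a, c a ≠ 0 → ¬ IsArrowBranch br a ∧ ¬ HasMonomial I br a := fun a ha =>
        ⟨fun h => ha (eq_zero_of_isArrowBranch hI hc.1.1 h),
          fun h => ha (eq_zero_of_branch_mem hc ((hasMonomial_iff br _).1 h))⟩
      by_cases hab : a = b
      · rw [hab]
      · have hadj : (QRho I br).Adj ⟨a, aux a ha⟩ ⟨b, aux b hb⟩ :=
          ⟨fun h => hab (congrArg Subtype.val h), c, hc, ha, hb⟩
        have := SimpleGraph.ConnectedComponent.connectedComponentMk_eq_of_adj hadj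
        simp only [aux a ha, aux b hb, not_false_eq_true, and_self, exists_true_left, this]
    · intro a ha
      by_cases h : HasMonomial I br a
      · rw [tElt_apply_of_not_vertex hQ κ fun h' => h'.2 h, if_neg, zero_smul]
        rintro ⟨h', -⟩
        exact h'.2 h
      · rw [tElt_apply_vertex hQ κ ⟨a, ha, h⟩]
        simp only [ha, h, not_false_eq_true, and_self, exists_true_left]
        split_ifs
        · rw [one_smul]
        · rw [zero_smul]
  · change branchPar I br p.1 q.1 ∈ kerD1 I br
    rw [mem_kerD1_iff (Λ := 0) hQ hI (branchPar_mem_homArrows hQ p.2 _)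
      fun α hα => branchPar_apply_of_ne_source hQ _ _ hα]
    · exact fun _ _ _ _ _ _ => rfl
    · intro a ha
      rw [branchPar_apply_of_ne hQ, Pi.zero_apply, zero_smul]
      rintro rfl
      exact ha p.2

/-- The coefficients of `s` with respect to the generators. -/
def sVec (I : Ideal (PathAlgebra k V)) (br : Fin N ≃ Path o t) : GenIndex I br → k :=
  Sum.elim (fun _ => 1) (Sum.elim (fun _ => 1) fun pq => if pq.1.1 = pq.2.1 then 1 else 0)

/-- The values on first arrows determine all coefficients: those of the `y_i` and `t_κ` because
arrows are nonzero in the quotient, the others because irreducible branches are independent. With `r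
= 0` this is the independence of the generators as families. -/
theorem eq_smul_sVec (hQ : IsToupie o t) (hI : IsAdmissible I) {c : GenIndex I br → k} {r : k}
    (h : ∀ i, genComb I br c (firstArrow br hQ i) = r • arrowCls I (firstArrow br hQ i)) :
    c = r • sVec I br := by
  have hcancel : ∀ (α : Arrow V) (a b : k), a • arrowCls I α = b • arrowCls I α → a = b :=
    fun α a b hab => smul_left_injective k (arrowCls_ne_zero hI α) hab
  funext j
  rcases j with i | κ | ⟨p, q⟩
  · have := h i.1
    rw [genComb_apply_of_hasMonomial hQ hI] at this
    rw [hcancel _ _ _ this]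
    simp [sVec]
  · induction κ using SimpleGraph.ConnectedComponent.ind with
    | h i =>
    have := h i.1
    rw [genComb_apply_vertex hQ] at this
    rw [hcancel _ _ _ this]
    simp [sVec]
  · have hp := h p.1
    rw [genComb_apply_arrow hQ hI, ← cls_branch_of_isArrowBranch hQ p.2] at hp
    have hirr := isIrreducibleBranch_of_isArrowBranch hI p.2
    have h0 : ∑ q, (c (Sum.inr (Sum.inr (p, q))) - if q = ⟨p.1, hirr⟩ then r else 0) •
        cls I (br q.1) = 0 := by
      simp_rw [sub_smul]
      rw [Finset.sum_sub_distrib, hp]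
      simp [ite_smul]
    have := Fintype.linearIndependent_iff.1 (linearIndependent_irreducible (I := I) (br := br))
      _ h0 q
    rw [sub_eq_zero.1 this]
    simp [sVec, Subtype.ext_iff, eq_comm]

theorem genComb_sVec (hQ : IsToupie o t) (hI : IsAdmissible I) :
    genComb I br (sVec I br) = sElt I br := by
  have hs : ∀ i, sElt I br (firstArrow br hQ i) = arrowCls I (firstArrow br hQ i) := by
    intro i
    rw [sElt, Finset.sum_apply, Finset.sum_eq_single i, diag_zero_apply_self hQ]
    · intro j _ hj
      exact diag_zero_apply_of_ne hQ hj.symm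
    · simp
  funext ⟨a, b, α⟩
  by_cases ha : a = o
  · subst ha
    obtain ⟨i, hi⟩ := exists_firstArrow_eq br hQ α
    rw [← hi, hs]
    by_cases harr : IsArrowBranch br i
    · rw [genComb_apply_arrow hQ hI _ ⟨i, harr⟩,
        Finset.sum_eq_single ⟨i, isIrreducibleBranch_of_isArrowBranch hI harr⟩,
        ← cls_branch_of_isArrowBranch hQ harr]
      · simp [sVec]
      · intro q _ hq
        have : i ≠ q.1 := fun h => hq (Subtype.ext h.symm)
        simp [sVec, this]
      · simp
    · by_cases hmon : HasMonomial I br i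
      · rw [genComb_apply_of_hasMonomial hQ hI _ ⟨i, hmon⟩]
        simp [sVec]
      · rw [genComb_apply_vertex hQ _ ⟨i, harr, hmon⟩]
        simp [sVec]
  · rw [genComb_apply_of_ne_source hQ _ ha, sElt, Finset.sum_apply,
      Finset.sum_eq_zero fun i _ => diag_zero_apply_of_ne_source hQ i ha]

/-- The only relations between the generators are the multiples of `s`. -/
theorem exists_eq_smul_sVec (hQ : IsToupie o t) (hI : IsAdmissible I) {c : GenIndex I br → k}
    (h : genComb I br c ∈ imD0 I) : ∃ r : k, c = r • sVec I br := by
  obtain ⟨γ, hγ⟩ := (mem_imD0_iff hQ).1 h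
  -- The combination vanishes on arrows that do not leave the source, so the potential takes the
  -- value `γ t` at every other vertex, and each first arrow gets the factor `γ t - γ o`.
  have hconst : ∀ {x : V} (_ : x ≠ o) {b : V} (_ : Path x b), γ b = γ x := by
    intro x hx b p
    induction p with
    | nil => rfl
    | @cons b c p α ih =>
      have h1 := hγ ⟨b, c, α⟩
      rw [genComb_apply_of_ne_source hQ _ (hQ.ne_source_of_path hx p)] at h1
      have h2 := (smul_eq_zero.1 h1.symm).resolve_right (arrowCls_ne_zero hI _)
      rw [← ih]
      exact sub_eq_zero.1 h2
  refine ⟨γ t - γ o, eq_smul_sVec hQ hI fun i => ?_⟩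
  rw [hγ, hconst (hQ.ne_source_of_arrow (headArrow br hQ i)) (branchTail br hQ i)]
  rfl

/-- A family of scalars on the arrows that do not start at the source is the coboundary of a
potential. -/
theorem exists_potential (hQ : IsToupie o t) (l : Arrow V → k) :
    ∃ γ : V → k, ∀ α : Arrow V, α.1 ≠ o → γ α.2.1 - γ α.1 = l α := by
  let p : ∀ x, Path x t := fun x => (hQ.nonempty_path_sink x).some
  -- Minus the sum of `l` along a path to the sink. From `x ≠ o` this path is unique, so it begins
  -- with the arrow `α` and the difference is `l α`; the path chosen at the source plays no role.
  refine ⟨fun x => -((arrows (p x)).map l).sum, ?_⟩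
  rintro ⟨x, y, α⟩ hx
  change -((arrows (p y)).map l).sum - -((arrows (p x)).map l).sum = _
  rw [hQ.path_to_sink_unique hx (p x) (α.toPath.comp (p y)), arrows_toPath_comp, List.map_cons,
    List.sum_cons]
  ring

/-- The generators span `Ker D_1` modulo `Im D_0`. -/
theorem exists_sub_genComb_mem (hQ : IsToupie o t) (hI : IsAdmissible I)
    {f : Arrow V → PathAlgebra k V ⧸ I} (hf : f ∈ kerD1 I br) :
    ∃ c : GenIndex I br → k, f - genComb I br c ∈ imD0 I := by
  have hl : ∀ α : Arrow V, ∃ r : k, (α.1 = o → α.2.1 ≠ t) → f α = r • arrowCls I α := by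
    intro α
    by_cases h : α.1 = o → α.2.1 ≠ t
    · have hmem := corner_cls_mem_span I α.1 α.2.1 (f α)
      have hr : (Set.range fun p : Path α.1 α.2.1 => cls I p) = {arrowCls I α} := by
        ext z
        constructor
        · rintro ⟨p, rfl⟩
          rw [hQ.path_unique h p α.2.2.toPath]
          rfl
        · rintro rfl
          exact ⟨_, rfl⟩
      rw [hf.1 α, hr, Submodule.mem_span_singleton] at hmem
      obtain ⟨r, hr⟩ := hmem
      exact ⟨r, fun _ => hr.symm⟩
    -- A dummy scalar at arrows from source to sink, whose values need not be diagonal; they are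
    -- treated separately through `m`.
    · exact ⟨0, fun h' => absurd h' h⟩
  choose l hl using hl
  obtain ⟨γ, hγ⟩ := exists_potential hQ l
  have hD : D0 I (potential I γ) ∈ imD0 I := ⟨_, potential_mem_homE γ, rfl⟩
  suffices h : ∃ c, f - D0 I (potential I γ) = genComb I br c by
    obtain ⟨c, hc⟩ := h
    refine ⟨c, ?_⟩
    rwa [← hc, sub_sub_cancel]
  have hg := Submodule.sub_mem _ hf (imD0_le_kerD1 (br := br) hD)
  have h0 : ∀ α : Arrow V, α.1 ≠ o → (f - D0 I (potential I γ)) α = 0 := fun α hα => by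
    rw [Pi.sub_apply, D0_potential, hγ α hα, hl α fun h => absurd h hα, sub_self]
  have h1 : ∀ i, ¬ IsArrowBranch br i → (f - D0 I (potential I γ)) (firstArrow br hQ i) =
      (l (firstArrow br hQ i) - (γ (headVertex br hQ i) - γ o)) •
        arrowCls I (firstArrow br hQ i) := fun i hi => by
    rw [Pi.sub_apply, D0_potential, hl _ fun _ h => hi ((isArrowBranch_iff br hQ i).2 h), ← sub_smul]
    rfl
  generalize f - D0 I (potential I γ) = g at hg h0 h1
  generalize hΛ : (fun i => l (firstArrow br hQ i) - (γ (headVertex br hQ i) - γ o)) = Λ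
  replace h1 : ∀ i, ¬ IsArrowBranch br i →
      g (firstArrow br hQ i) = Λ i • arrowCls I (firstArrow br hQ i) := fun i hi => by
    rw [h1 i hi, ← hΛ]
  have hrel := (mem_kerD1_iff hQ hI hg.1 h0 h1).1 hg
  -- Equality along edges makes `Λ` constant on components, so its value at any representative
  -- serves as the coefficient of `tElt`.
  have hreach : ∀ a b : QRhoVertex I br, (QRho I br).Reachable a b → Λ a.1 = Λ b.1 := by
    rintro a b ⟨p⟩
    induction p with
    | nil => rfl
    | cons hab _ ih =>
      obtain ⟨-, c, hc, ha, hb⟩ := hab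
      exact (hrel c hc _ _ ha hb).trans ih
  have hm : ∀ p : {p // IsArrowBranch br p}, ∃ m : {q // IsIrreducibleBranch I br q} → k,
      g (firstArrow br hQ p.1) = ∑ q, m q • cls I (br q.1) := by
    intro p
    obtain ⟨m, hm⟩ := corner_eq_sum_irreducible (br := br) (g (firstArrow br hQ p.1))
    refine ⟨m, ?_⟩
    rw [← hm]
    have h2 : idem I o * g (firstArrow br hQ p.1) * idem I (headVertex br hQ p.1) =
        g (firstArrow br hQ p.1) := hg.1 (firstArrow br hQ p.1)
    rw [(isArrowBranch_iff br hQ p.1).1 p.2] at h2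
    exact h2.symm
  choose m hm using hm
  refine ⟨Sum.elim (fun i => Λ i.1) (Sum.elim (fun κ => Λ κ.out.1) fun pq => m pq.1 pq.2),
    funext ?_⟩
  rintro ⟨a, b, α⟩
  by_cases ha : a = o
  · subst ha
    obtain ⟨i, hi⟩ := exists_firstArrow_eq br hQ α
    rw [← hi]
    by_cases harr : IsArrowBranch br i
    · rw [genComb_apply_arrow hQ hI _ ⟨i, harr⟩]
      exact hm ⟨i, harr⟩
    · rw [h1 i harr]
      by_cases hmon : HasMonomial I br i
      · rw [genComb_apply_of_hasMonomial hQ hI _ ⟨i, hmon⟩]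
        rfl
      · rw [genComb_apply_vertex hQ _ ⟨i, harr, hmon⟩]
        simp only [Sum.elim_inr, Sum.elim_inl]
        rw [hreach ⟨i, harr, hmon⟩ _ (SimpleGraph.ConnectedComponent.exact (Quot.out_eq _).symm)]
  · rw [genComb_apply_of_ne_source hQ _ ha, h0 _ ha]

end Generators

/-! ## The basis -/

/-! ### Discarding a generator from a family with one relation -/

section LinearAlgebra

variable {k H J : Type*} [Field k] [AddCommGroup H] [Module k H] [Fintype J] [DecidableEq J]
  {b : J → H} {s ε : J → k} {j₀ : J}

/-- If the relations of a generating family are the multiples of `s`, then the vectors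
`b j - ε j • b j₀`, `j ≠ j₀`, are linearly independent and generate. -/
theorem linearIndependent_sub_smul
    (hrel : ∀ c : J → k, ∑ j, c j • b j = 0 → ∃ r : k, c = r • s)
    (hne : s j₀ + ∑ j : {j // j ≠ j₀}, s j.1 * ε j.1 ≠ 0) :
    LinearIndependent k fun j : {j // j ≠ j₀} => b j.1 - ε j.1 • b j₀ := by
  rw [Fintype.linearIndependent_iff]
  intro g hg
  -- Expanding the combination, `b j₀` gets the coefficient `-∑ g j * ε j`. Since all coefficients
  -- are `r * s j`, comparison at `j₀` gives `r` times the scalar of `hne` equal to `0`.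
  obtain ⟨r, hr⟩ := hrel
    (fun j => if h : j ≠ j₀ then g ⟨j, h⟩ else -∑ j : {j // j ≠ j₀}, g j * ε j.1) (by
      rw [Fintype.sum_eq_add_sum_subtype_ne _ j₀, dif_neg (not_not.2 rfl), ← hg]
      have h1 : ∀ j : {j // j ≠ j₀},
          (if h : j.1 ≠ j₀ then g ⟨j.1, h⟩ else -∑ j : {j // j ≠ j₀}, g j * ε j.1) • b j.1 =
            g j • b j.1 := fun j => by rw [dif_pos j.2]
      simp_rw [h1, smul_sub, Finset.sum_sub_distrib, smul_smul, ← Finset.sum_smul, neg_smul]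
      abel)
  have hgr : ∀ j : {j // j ≠ j₀}, g j = r * s j.1 := fun j => by
    have := congrFun hr j.1
    simpa only [dif_pos j.2, Pi.smul_apply, smul_eq_mul] using this
  have h0 : -∑ j : {j // j ≠ j₀}, g j * ε j.1 = r * s j₀ := by
    have := congrFun hr j₀
    simpa only [ne_eq, not_true, dite_false, Pi.smul_apply, smul_eq_mul] using this
  have hr0 : r * (s j₀ + ∑ j : {j // j ≠ j₀}, s j.1 * ε j.1) = 0 := by
    rw [mul_add, ← h0, Finset.mul_sum]
    simp_rw [hgr, mul_assoc]
    exact neg_add_cancel _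
  intro j
  rw [hgr, (mul_eq_zero.1 hr0).resolve_right hne, zero_mul]

/-- In `∑ s j • b j = 0` write each `b j` as the corrected vector plus `ε j • b j₀`. A nonzero
multiple of `b j₀` is then in the span of the corrected vectors. -/
theorem top_le_span_sub_smul (hspan : ⊤ ≤ Submodule.span k (Set.range b))
    (hs : ∑ j, s j • b j = 0) (hne : s j₀ + ∑ j : {j // j ≠ j₀}, s j.1 * ε j.1 ≠ 0) :
    ⊤ ≤ Submodule.span k (Set.range fun j : {j // j ≠ j₀} => b j.1 - ε j.1 • b j₀) := by
  set S := Submodule.span k (Set.range fun j : {j // j ≠ j₀} => b j.1 - ε j.1 • b j₀) with hS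
  have hv : ∀ j : {j // j ≠ j₀}, b j.1 - ε j.1 • b j₀ ∈ S := fun j =>
    Submodule.subset_span ⟨j, rfl⟩
  have h1 : (s j₀ + ∑ j : {j // j ≠ j₀}, s j.1 * ε j.1) • b j₀ =
      -∑ j : {j // j ≠ j₀}, s j.1 • (b j.1 - ε j.1 • b j₀) := by
    rw [eq_neg_iff_add_eq_zero, ← hs, Fintype.sum_eq_add_sum_subtype_ne _ j₀, add_smul,
      Finset.sum_smul]
    simp_rw [smul_sub, Finset.sum_sub_distrib, smul_smul]
    abel
  have h0 : b j₀ ∈ S := by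
    have h2 : (s j₀ + ∑ j : {j // j ≠ j₀}, s j.1 * ε j.1) • b j₀ ∈ S := by
      rw [h1]
      exact S.neg_mem (S.sum_mem fun j _ => S.smul_mem _ (hv j))
    exact (S.smul_mem_iff hne).1 h2
  refine hspan.trans (Submodule.span_le.2 ?_)
  rintro _ ⟨j, rfl⟩
  by_cases hj : j = j₀
  · rw [hj]
    exact h0
  · have := S.add_mem (hv ⟨j, hj⟩) (S.smul_mem (ε j) h0)
    rwa [sub_add_cancel] at this

end LinearAlgebra

section Main

open Quiver (Path)

open scoped Classical

variable {k : Type w} {V : Type u} [Field k] [Quiver.{v} V] [Fintype V] {o t : V}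
  {I : Ideal (PathAlgebra k V)} {N : ℕ} {br : Fin N ≃ Path o t}

/-- The index of `α ∥ α`, for a branch `α` that is an arrow. -/
def arrowIndex (hI : IsAdmissible I) {i : Fin N} (hi : IsArrowBranch br i) : GenIndex I br :=
  Sum.inr (Sum.inr (⟨i, hi⟩, ⟨i, isIrreducibleBranch_of_isArrowBranch hI hi⟩))

/-- The correction that turns `α^(j) ∥ α^(j)` into `x_j`. -/
def diagonalIndicator (I : Ideal (PathAlgebra k V)) (br : Fin N ≃ Path o t) :
    GenIndex I br → k :=
  Sum.elim 0 (Sum.elim 0 fun pq => if pq.1.1 = pq.2.1 then 1 else 0)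

/-- The scalar is `1` plus the number of the other branches that are arrows, that is, the positive
integer $a$. Only here is characteristic `0` needed. -/
theorem sVec_add_sum_ne_zero_of_arrow [CharZero k] (hI : IsAdmissible I) {i : Fin N}
    (hi : IsArrowBranch br i) :
    sVec I br (arrowIndex hI hi) + ∑ j : {j // j ≠ arrowIndex hI hi},
      sVec I br j.1 * diagonalIndicator I br j.1 ≠ 0 := by
  have h1 : ∀ j, sVec I br j * diagonalIndicator I br j =
      if diagonalIndicator I br j = 1 then 1 else 0 := by
    rintro (j | j | j)
    · simp [sVec, diagonalIndicator]
    · simp [sVec, diagonalIndicator]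
    · by_cases h : j.1.1 = j.2.1 <;> simp [sVec, diagonalIndicator, h]
  have h2 : sVec I br (arrowIndex hI hi) = 1 := by simp [sVec, arrowIndex]
  simp_rw [h1, h2]
  rw [Finset.sum_boole, add_comm]
  exact Nat.cast_add_one_ne_zero _

variable [I.IsTwoSided]

/-- The generators, all but one, corrected by multiples of the remaining one. -/
def reducedGen (I : Ideal (PathAlgebra k V)) [I.IsTwoSided] (br : Fin N ≃ Path o t)
    (j₀ : GenIndex I br) (ε : GenIndex I br → k) (j : {j // j ≠ j₀}) :
    Arrow V → PathAlgebra k V ⧸ I :=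
  gen I br j.1 - ε j.1 • gen I br j₀

theorem reducedGen_mem_kerD1 (hQ : IsToupie o t) (hI : IsAdmissible I) (j₀ : GenIndex I br)
    (ε : GenIndex I br → k) (j : {j // j ≠ j₀}) : reducedGen I br j₀ ε j ∈ kerD1 I br :=
  Submodule.sub_mem _ (gen_mem_kerD1 hQ hI _) (Submodule.smul_mem _ _ (gen_mem_kerD1 hQ hI _))

theorem toHH1_eq_zero_iff (hQ : IsToupie o t) (f : kerD1 I br) :
    toHH1 hQ f = 0 ↔ f.1 ∈ imD0 I := by
  rw [← LinearMap.mem_ker, ker_toHH1]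
  rfl

/-- The classes of the generators in `HH^1(A)`. -/
def genClass (hQ : IsToupie o t) (hI : IsAdmissible I) (j : GenIndex I br) :
    HH1 k (PathAlgebra k V ⧸ I) :=
  toHH1 hQ ⟨gen I br j, gen_mem_kerD1 hQ hI j⟩

theorem genComb_mem_kerD1 (hQ : IsToupie o t) (hI : IsAdmissible I) (c : GenIndex I br → k) :
    genComb I br c ∈ kerD1 I br :=
  Submodule.sum_mem _ fun j _ => Submodule.smul_mem _ _ (gen_mem_kerD1 hQ hI j)

theorem sum_smul_genClass (hQ : IsToupie o t) (hI : IsAdmissible I) (c : GenIndex I br → k) :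
    ∑ j, c j • genClass hQ hI j = toHH1 hQ ⟨genComb I br c, genComb_mem_kerD1 hQ hI c⟩ := by
  have h : (⟨genComb I br c, genComb_mem_kerD1 hQ hI c⟩ : kerD1 I br) =
      ∑ j, c j • ⟨gen I br j, gen_mem_kerD1 hQ hI j⟩ := by
    refine Subtype.ext ?_
    simp only [AddSubmonoidClass.coe_finsetSum, Submodule.coe_smul, genComb]
  rw [h, map_sum]
  simp only [map_smul]
  rfl

theorem sum_smul_genClass_eq_zero_iff (hQ : IsToupie o t) (hI : IsAdmissible I)
    (c : GenIndex I br → k) : ∑ j, c j • genClass hQ hI j = 0 ↔ genComb I br c ∈ imD0 I := by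
  rw [sum_smul_genClass, toHH1_eq_zero_iff]

theorem top_le_span_genClass (hQ : IsToupie o t) (hI : IsAdmissible I) :
    ⊤ ≤ Submodule.span k (Set.range (genClass (br := br) hQ hI)) := by
  intro z _
  obtain ⟨f, rfl⟩ := toHH1_surjective (br := br) hQ z
  obtain ⟨c, hc⟩ := exists_sub_genComb_mem hQ hI f.2
  have h0 : toHH1 hQ (f - ⟨genComb I br c, genComb_mem_kerD1 hQ hI c⟩) = 0 :=
    (toHH1_eq_zero_iff hQ _).2 hc
  rw [map_sub, sub_eq_zero] at h0
  rw [h0, ← sum_smul_genClass hQ hI]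
  exact Submodule.sum_mem _ fun j _ => Submodule.smul_mem _ _ (Submodule.subset_span ⟨j, rfl⟩)

theorem genClass_sub_smul (hQ : IsToupie o t) (hI : IsAdmissible I) (j₀ : GenIndex I br)
    (ε : GenIndex I br → k) (j : {j // j ≠ j₀}) :
    genClass hQ hI j.1 - ε j.1 • genClass hQ hI j₀ =
      toHH1 hQ ⟨reducedGen I br j₀ ε j, reducedGen_mem_kerD1 hQ hI j₀ ε j⟩ := by
  unfold genClass
  rw [← map_smul, ← map_sub]
  rfl

theorem exists_basis_reducedGen (hQ : IsToupie o t) (hI : IsAdmissible I) (j₀ : GenIndex I br)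
    (ε : GenIndex I br → k)
    (hne : sVec I br j₀ + ∑ j : {j // j ≠ j₀}, sVec I br j.1 * ε j.1 ≠ 0) :
    ∃ B : Module.Basis {j // j ≠ j₀} k (HH1 k (PathAlgebra k V ⧸ I)),
      ∀ j, B j = toHH1 hQ ⟨reducedGen I br j₀ ε j, reducedGen_mem_kerD1 hQ hI j₀ ε j⟩ := by
  have hli := linearIndependent_sub_smul (b := genClass hQ hI) (ε := ε) (j₀ := j₀)
    (fun c hc => exists_eq_smul_sVec hQ hI ((sum_smul_genClass_eq_zero_iff hQ hI c).1 hc)) hne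
  have hs : ∑ j, sVec I br j • genClass hQ hI j = 0 := by
    rw [sum_smul_genClass_eq_zero_iff, genComb_sVec hQ hI]
    exact sElt_mem_imD0 hQ
  have hspan := top_le_span_sub_smul (ε := ε) (j₀ := j₀) (top_le_span_genClass hQ hI) hs hne
  refine ⟨Module.Basis.mk hli hspan, fun j => ?_⟩
  rw [Module.Basis.mk_apply]
  exact genClass_sub_smul hQ hI j₀ ε j

/-- The elements of the basis are not coboundaries, and they are indexed without repetition. -/
theorem exists_basis_of_range_eq (hQ : IsToupie o t) (hI : IsAdmissible I) {j₀ : GenIndex I br}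
    {ε : GenIndex I br → k}
    (hne : sVec I br j₀ + ∑ j : {j // j ≠ j₀}, sVec I br j.1 * ε j.1 ≠ 0)
    {S : Set (Arrow V → PathAlgebra k V ⧸ I)} (hS : S = Set.range (reducedGen I br j₀ ε)) :
    Disjoint S (setK I br) ∧ ∃ B : Module.Basis S k (HH1 k (PathAlgebra k V ⧸ I)),
      ∀ f : S, ∃ hf : f.1 ∈ kerD1 I br, B f = toHH1 hQ ⟨f.1, hf⟩ := by
  obtain ⟨B, hB⟩ := exists_basis_reducedGen hQ hI j₀ ε hne
  -- The basis is to be indexed by a set of families, so distinct indices must give distinct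
  -- families; this follows from the distinctness of their classes.
  have hinj : Function.Injective (reducedGen I br j₀ ε) := by
    intro i j h
    apply B.injective
    rw [hB, hB]
    congr 2
  subst hS
  refine ⟨Set.disjoint_left.2 ?_, B.reindex (Equiv.ofInjective _ hinj), ?_⟩
  · rintro _ ⟨j, rfl⟩ hK
    apply B.ne_zero j
    rw [hB, toHH1_eq_zero_iff]
    exact setK_subset_imD0 hQ hK
  · rintro ⟨_, j, rfl⟩
    refine ⟨reducedGen_mem_kerD1 hQ hI j₀ ε j, ?_⟩
    rw [← hB, Module.Basis.reindex_apply]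
    congr 1
    exact Equiv.ofInjective_symm_apply hinj j

/-- Needed when no branch is an arrow: `setLast` is removed as a set, so no other generator may
coincide with the one dropped. -/
theorem gen_injective (hQ : IsToupie o t) (hI : IsAdmissible I) :
    Function.Injective (gen I br) := by
  intro i j h
  by_contra hij
  have h0 : genComb I br (Pi.single i 1 - Pi.single j 1) = 0 := by
    simp [genComb, sub_smul, Pi.single_apply, ite_smul, h]
  have := eq_smul_sVec hQ hI (r := 0) (c := Pi.single i 1 - Pi.single j 1) fun l => by
    rw [h0, zero_smul]
    rfl
  have := congrFun this i
  simp [hij] at this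

section ArrowCase

/-- The generator dropped is `α ∥ α` for the first branch that is an arrow. The correction affects
only the diagonal pairs, which become the `x_j`; the other pairs are the `w_pq` and `z_us`. -/
theorem range_reducedGen_arrow (hI : IsAdmissible I) {i : Fin N} (hi : IsArrowBranch br i)
    (hmin : ∀ l, IsArrowBranch br l → i ≤ l) :
    setY I br ∪ setW I br ∪ setZ I br ∪ setX I br ∪ setT I br =
      Set.range (reducedGen I br (arrowIndex hI hi) (diagonalIndicator I br)) := by
  apply Set.Subset.antisymm
  · rintro f ((((⟨j, hj, rfl⟩ | ⟨p, q, hp, hq, hpq, rfl⟩) | ⟨p, q, hp, hq, hirr, rfl⟩) |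
      ⟨l, j, hl, hlmin, hj, hne, rfl⟩) | ⟨κ, rfl⟩)
    · exact ⟨⟨Sum.inl ⟨j, hj⟩, by simp [arrowIndex]⟩, by
        simp [reducedGen, gen, diagonalIndicator]⟩
    · refine ⟨⟨Sum.inr (Sum.inr (⟨p, hp⟩, ⟨q, isIrreducibleBranch_of_isArrowBranch hI hq⟩)), ?_⟩,
        ?_⟩
      · intro h
        simp only [arrowIndex, Sum.inr.injEq, Prod.mk.injEq, Subtype.mk.injEq] at h
        exact hpq (h.1.trans h.2.symm)
      · simp [reducedGen, gen, diagonalIndicator, hpq]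
    · have hpq : p ≠ q := by
        rintro rfl
        exact hq hp
      refine ⟨⟨Sum.inr (Sum.inr (⟨p, hp⟩, ⟨q, hirr⟩)), ?_⟩, ?_⟩
      · intro h
        simp only [arrowIndex, Sum.inr.injEq, Prod.mk.injEq, Subtype.mk.injEq] at h
        exact hpq (h.1.trans h.2.symm)
      · simp [reducedGen, gen, diagonalIndicator, hpq]
    · obtain rfl : l = i := le_antisymm (hlmin i hi) (hmin l hl)
      refine ⟨⟨arrowIndex hI hj, ?_⟩, ?_⟩
      · intro h
        simp only [arrowIndex, Sum.inr.injEq, Prod.mk.injEq, Subtype.mk.injEq] at h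
        exact hne h.1
      · simp [reducedGen, gen, diagonalIndicator, arrowIndex]
    · exact ⟨⟨Sum.inr (Sum.inl κ), by simp [arrowIndex]⟩, by
        simp [reducedGen, gen, diagonalIndicator]⟩
  · rintro _ ⟨⟨j | κ | ⟨⟨p, hp⟩, ⟨q, hq⟩⟩, hne⟩, rfl⟩
    · refine Or.inl (Or.inl (Or.inl (Or.inl ⟨j.1, j.2, ?_⟩)))
      simp [reducedGen, gen, diagonalIndicator]
    · refine Or.inr ⟨κ, ?_⟩
      simp [reducedGen, gen, diagonalIndicator]
    · by_cases hpq : p = q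
      · subst hpq
        refine Or.inl (Or.inr ⟨i, p, hi, hmin, hp, ?_, ?_⟩)
        · rintro rfl
          exact hne rfl
        · simp [reducedGen, gen, diagonalIndicator, arrowIndex]
      · by_cases hqa : IsArrowBranch br q
        · refine Or.inl (Or.inl (Or.inl (Or.inr ⟨p, q, hp, hqa, hpq, ?_⟩)))
          simp [reducedGen, gen, diagonalIndicator, hpq]
        · refine Or.inl (Or.inl (Or.inr ⟨p, q, hp, hqa, hq, ?_⟩))
          simp [reducedGen, gen, diagonalIndicator, hpq]

end ArrowCase

section NoArrowCase

/-- As no branch is an arrow, the last one either contains a monomial relation or is a vertex of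
`QRho`, so a single generator involves it. Its coefficient `1` in `s` allows dropping it without
correction. -/
theorem exists_setLast_eq (hQ : IsToupie o t) (ha : ¬ ∃ i, IsArrowBranch br i) :
    ∃ j₀, setLast I br = {gen I br j₀} ∧ sVec I br j₀ = 1 := by
  have hne : Nonempty (Fin N) := by
    obtain ⟨p⟩ := hQ.nonempty_path_sink o
    exact ⟨br.symm p⟩
  obtain ⟨B, hB⟩ := Finite.exists_max (id : Fin N → Fin N)
  have huniq : ∀ B', (∀ i, i ≤ B') → B' = B := fun B' h => le_antisymm (hB B') (h B)
  have hBa : ¬ IsArrowBranch br B := fun h => ha ⟨B, h⟩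
  by_cases hmon : HasMonomial I br B
  · refine ⟨Sum.inl ⟨B, hmon⟩, Set.Subset.antisymm ?_ ?_, rfl⟩
    · rintro f ⟨B', hB', h⟩
      obtain rfl := huniq B' hB'
      rcases h with ⟨-, rfl⟩ | ⟨h, -⟩
      · rfl
      · exact absurd hmon h.2
    · rintro _ rfl
      exact ⟨B, hB, Or.inl ⟨hmon, rfl⟩⟩
  · refine ⟨Sum.inr (Sum.inl ((QRho I br).connectedComponentMk ⟨B, hBa, hmon⟩)),
      Set.Subset.antisymm ?_ ?_, rfl⟩
    · rintro f ⟨B', hB', h⟩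
      obtain rfl := huniq B' hB'
      rcases h with ⟨h, -⟩ | ⟨h, rfl⟩
      · exact absurd h hmon
      · rfl
    · rintro _ rfl
      exact ⟨B, hB, Or.inr ⟨⟨hBa, hmon⟩, rfl⟩⟩

theorem range_reducedGen_of_no_arrow (hQ : IsToupie o t) (hI : IsAdmissible I)
    (ha : ¬ ∃ i, IsArrowBranch br i) {j₀ : GenIndex I br} (hj₀ : setLast I br = {gen I br j₀}) :
    (setY I br ∪ setT I br) \ setLast I br = Set.range (reducedGen I br j₀ 0) := by
  rw [hj₀]
  apply Set.Subset.antisymm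
  · rintro f ⟨⟨j, hj, rfl⟩ | ⟨κ, rfl⟩, hne⟩
    · refine ⟨⟨Sum.inl ⟨j, hj⟩, ?_⟩, ?_⟩
      · rintro rfl
        exact hne rfl
      · simp [reducedGen, gen]
    · refine ⟨⟨Sum.inr (Sum.inl κ), ?_⟩, ?_⟩
      · rintro rfl
        exact hne rfl
      · simp [reducedGen, gen]
  · rintro _ ⟨⟨j, hne⟩, rfl⟩
    have hred : reducedGen I br j₀ 0 ⟨j, hne⟩ = gen I br j := by simp [reducedGen]
    rw [hred]
    refine ⟨?_, fun h => hne (gen_injective hQ hI h)⟩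
    rcases j with j | κ | ⟨⟨p, hp⟩, q⟩
    · exact Or.inl ⟨j.1, j.2, rfl⟩
    · exact Or.inr ⟨κ, rfl⟩
    · exact absurd ⟨p, hp⟩ ha

end NoArrowCase

/-- The remaining elements of `setUhat` all lie in `setK`, and disjointness ensures that nothing
else is removed. -/
theorem setUhat_diff_setK_of_arrow (ha : ∃ i, IsArrowBranch br i)
    (hd : Disjoint (setY I br ∪ setW I br ∪ setZ I br ∪ setX I br ∪ setT I br) (setK I br)) :
    setUhat I br \ setK I br =
      setY I br ∪ setW I br ∪ setZ I br ∪ setX I br ∪ setT I br := by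
  rw [setUhat, if_pos ha]
  ext f
  have : f ∈ _ → f ∉ setK I br := fun h => Set.disjoint_left.1 hd h
  simp only [setK, Set.mem_sdiff, Set.mem_union, Set.mem_singleton_iff] at this ⊢
  tauto

theorem setUhat_diff_setK_of_no_arrow (ha : ¬ ∃ i, IsArrowBranch br i)
    (hd : Disjoint ((setY I br ∪ setT I br) \ setLast I br) (setK I br)) :
    setUhat I br \ setK I br = (setY I br ∪ setT I br) \ setLast I br := by
  rw [setUhat, if_neg ha]
  ext f
  have : f ∈ _ → f ∉ setK I br := fun h => Set.disjoint_left.1 hd h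
  simp only [setK, Set.mem_sdiff, Set.mem_union, Set.mem_singleton_iff] at this ⊢
  tauto

end Main

end Toupie
end

open Toupie
theorem mainTheorem12 {k : Type w} [Field k] [CharZero k]
    {V : Type u} [Quiver.{v} V] [Fintype V] [∀ a b : V, Finite (a ⟶ b)]
    {o t : V} (hQ : IsToupie o t) {N : ℕ} (br : Fin N ≃ Quiver.Path o t)
    (I : Ideal (PathAlgebra k V)) [I.IsTwoSided] (hI : IsAdmissible I) :
    imD0 I ≤ kerD1 I br ∧
    (∃ Φ : H1 I br ≃ₗ[k] HH1 k (PathAlgebra k V ⧸ I),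
      (∀ f : kerD1 I br, ∃ d : cocycles1 k (PathAlgebra k V ⧸ I),
        (∀ x : V, d.1 (idem I x) = 0) ∧ (∀ α : Arrow V, d.1 (arrowCls I α) = f.1 α) ∧
        Φ (Submodule.Quotient.mk f) = Submodule.Quotient.mk d) ∧
      ∃ B : Module.Basis ↥(setUhat I br \ setK I br) k (HH1 k (PathAlgebra k V ⧸ I)),
        ∀ f : ↥(setUhat I br \ setK I br), ∃ hf : f.1 ∈ kerD1 I br,
          B f = Φ (Submodule.Quotient.mk ⟨f.1, hf⟩)) ∧
    ((∃ i, IsArrowBranch br i) → setUhat I br \ setK I br =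
      setY I br ∪ setW I br ∪ setZ I br ∪ setX I br ∪ setT I br) ∧
    ((¬ ∃ i, IsArrowBranch br i) → setUhat I br \ setK I br =
      (setY I br ∪ setT I br) \ setLast I br) := by
  -- On the class of a cocycle `comparison` is by definition `toHH1`, so the basis can be found
  -- through `toHH1`.
  suffices h : (∃ B : Module.Basis ↥(setUhat I br \ setK I br) k (HH1 k (PathAlgebra k V ⧸ I)),
        ∀ f : ↥(setUhat I br \ setK I br), ∃ hf : f.1 ∈ kerD1 I br,
          B f = toHH1 hQ ⟨f.1, hf⟩) ∧
    ((∃ i, IsArrowBranch br i) → setUhat I br \ setK I br =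
      setY I br ∪ setW I br ∪ setZ I br ∪ setX I br ∪ setT I br) ∧
    ((¬ ∃ i, IsArrowBranch br i) → setUhat I br \ setK I br =
      (setY I br ∪ setT I br) \ setLast I br) from
    ⟨imD0_le_kerD1, ⟨comparison hQ, fun f => ⟨toCocycles hQ f, derivationOf_idem hQ f,
      derivationOf_arrow hQ f, comparison_mk hQ f⟩, h.1⟩, h.2⟩
  classical
  by_cases ha : ∃ i, IsArrowBranch br i
  · obtain ⟨⟨i, hi⟩, hmin⟩ :=
      @Finite.exists_min {i // IsArrowBranch br i} (Fin N) _ (nonempty_subtype.2 ha) _ Subtype.val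
    obtain ⟨hd, hB⟩ := exists_basis_of_range_eq hQ hI (sVec_add_sum_ne_zero_of_arrow hI hi)
      (range_reducedGen_arrow hI hi fun l hl => hmin ⟨l, hl⟩)
    have heq := setUhat_diff_setK_of_arrow ha hd
    rw [← heq] at hB
    exact ⟨hB, fun _ => heq, fun h => absurd ha h⟩
  · obtain ⟨j₀, hj₀, hs⟩ := exists_setLast_eq (I := I) hQ ha
    obtain ⟨hd, hB⟩ := exists_basis_of_range_eq hQ hI (j₀ := j₀) (ε := 0) (by simp [hs])
      (range_reducedGen_of_no_arrow hQ hI ha hj₀)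
    have heq := setUhat_diff_setK_of_no_arrow ha hd
    rw [← heq] at hB
    exact ⟨hB, fun h => absurd h ha, fun _ => heq⟩
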